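/- A \emph{temporal cost graph} $(G,F)$ consists of a finite graph $G$ with vertex set $V$, a number $T$ of time steps and a cost function $F\colon V\times V\times[T]\times[T]\to\mathbb{N}_0\cup\{\infty\}$ such that $F(u,v,t_1,t_2)=\infty$ whenever $t_1\ge t_2$, $F(v,v,t_1,t_2)=0$ whenever $t_1<t_2$ (waiting is free), and $F(u,v,t_1,t_2)>0$ whenever $u\neq v$; thus all costs of moves between distinct vertices are positive integers or $\infty$. A \emph{valid walk} is a finite sequence of quadruples $(u_i,v_i,t_i,t_i')$, $1\le i\le\ell$, with $t_i<t_i'$ and $F(u_i,v_i,t_i,t_i')<\infty$ for all $i$, and $v_i=u_{i+1}$ and $t_i'\le t_{i+1}$ for all $i<\ell$; it leads from $u_1$ to $v_\ell$, visits all the vertices $u_i$ and $v_i$, and its cost is $\sum_i F(u_i,v_i,t_i,t_i')$. The trivial walk ($\ell=0$) leads from any vertex $v$ to itself, visits only $v$ and has cost $0$. The problem \textsc{Changing Cost Temporal Orienteering} (CCTO) is: given a temporal cost graph $(G,F)$ (with $F$ given as an explicit table and all numbers in binary), vertices $v_s,v_t$, a target $k\in\mathbb{N}_0$ and a fuel budget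 $f\in\mathbb{N}_0$, decide whether there is a valid walk from $v_s$ to $v_t$ that visits at least $k$ distinct vertices and has cost at most $f$. Theorem. CCTO (all costs of moves between distinct vertices being positive integers or $\infty$) is fixed-parameter tractable with respect to the fuel budget $f$: there are a computable function $g\colon\mathbb{N}\to\mathbb{N}$, a constant $c$ and a single algorithm (a program for a random access machine with addition, truncated subtraction and halving, each elementary operation counted as one step) that decides every instance $x$ with budget $f$ in at most $g(f)\cdot|x|^{c}$ steps, where $|x|$ is the length of the input. -/

import Mathlib

/-! ### Random access machines with a step count -/

namespace RAM

/-- A machine state: registers and a random access memory, all cells holding natural numbers. -/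
structure State where
  reg : ℕ → ℕ
  mem : ℕ → ℕ

/-- Expressions: constants, registers, memory look-up at a computed address, addition, truncated
subtraction and halving. There is no multiplication, so that a value computed in `t` steps is at
most `O(t)` bits longer than the values present at the start, and counting one step per operation
is polynomially equivalent to Turing machine time. -/
inductive Expr where
  | const (c : ℕ)
  | reg (x : ℕ)
  | load (address : Expr)
  | add (a b : Expr)
  | sub (a b : Expr)
  | half (a : Expr)

/-- The value of an expression in a state. -/
def Expr.eval (σ : State) : Expr → ℕ
  | .const c => c
  | .reg x => σ.reg x
  | .load a => σ.mem (a.eval σ)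
  | .add a b => a.eval σ + b.eval σ
  | .sub a b => a.eval σ - b.eval σ
  | .half a => a.eval σ / 2

/-- The number of steps used to evaluate an expression: one for each node. -/
def Expr.steps : Expr → ℕ
  | .const _ => 1
  | .reg _ => 1
  | .load a => a.steps + 1
  | .add a b => a.steps + b.steps + 1
  | .sub a b => a.steps + b.steps + 1
  | .half a => a.steps + 1

/-- Programs. A condition holds if the value of the expression is not zero. -/
inductive Prog where
  | skip
  | assign (x : ℕ) (a : Expr)
  | store (address value : Expr)
  | seq (p q : Prog)
  | ite (cond : Expr) (p q : Prog)
  | loop (cond : Expr) (body : Prog)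

/-- `Exec p σ t τ`: the program `p`, started in the state `σ`, halts after exactly `t` steps in the
state `τ`. -/
inductive Exec : Prog → State → ℕ → State → Prop where
  | skip (σ : State) : Exec .skip σ 1 σ
  | assign (x : ℕ) (a : Expr) (σ : State) :
      Exec (.assign x a) σ (a.steps + 1) ⟨Function.update σ.reg x (a.eval σ), σ.mem⟩
  | store (a b : Expr) (σ : State) :
      Exec (.store a b) σ (a.steps + b.steps + 1)
        ⟨σ.reg, Function.update σ.mem (a.eval σ) (b.eval σ)⟩
  | seq {p q : Prog} {σ τ ρ : State} {s t : ℕ} :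
      Exec p σ s τ → Exec q τ t ρ → Exec (.seq p q) σ (s + t) ρ
  | ite_true {c : Expr} {p q : Prog} {σ τ : State} {t : ℕ} :
      c.eval σ ≠ 0 → Exec p σ t τ → Exec (.ite c p q) σ (c.steps + 1 + t) τ
  | ite_false {c : Expr} {p q : Prog} {σ τ : State} {t : ℕ} :
      c.eval σ = 0 → Exec q σ t τ → Exec (.ite c p q) σ (c.steps + 1 + t) τ
  | loop_true {c : Expr} {p : Prog} {σ τ ρ : State} {s t : ℕ} :
      c.eval σ ≠ 0 → Exec p σ s τ → Exec (.loop c p) τ t ρ →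
        Exec (.loop c p) σ (c.steps + 1 + s + t) ρ
  | loop_false {c : Expr} {p : Prog} {σ : State} :
      c.eval σ = 0 → Exec (.loop c p) σ (c.steps + 1) σ

/-- The initial state on an input word: the memory holds the input in its first cells, register `0`
holds the number of input cells, everything else is zero. -/
def init (input : List ℕ) : State where
  reg := fun x => if x = 0 then input.length else 0
  mem := fun i => input.getD i 0

/-- The size of an input word: the total number of binary digits, plus one for each entry. -/
def inputSize (input : List ℕ) : ℕ :=
  (input.map fun a => Nat.size a + 1).sum

/-- The decision problem `Yes` on the set `I` of instances, given to the machine through the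
encoding `enc`, is fixed-parameter tractable with respect to the parameter `κ`: one program decides
every instance `x` in at most `g (κ x) * |x| ^ c` steps, for some computable function `g` and some
constant `c`. The answer is left in register `0`. -/
def FixedParameterTractable {I : Type*} (enc : I → List ℕ) (κ : I → ℕ) (Yes : I → Prop) : Prop :=
  ∃ (p : Prog) (g : ℕ → ℕ) (c : ℕ), Computable g ∧
    ∀ x : I, ∃ (t : ℕ) (τ : State), Exec p (init (enc x)) t τ ∧
      t ≤ g (κ x) * inputSize (enc x) ^ c ∧
      (Yes x → τ.reg 0 = 1) ∧ (¬ Yes x → τ.reg 0 = 0)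

end RAM

/-! ### Temporal cost graphs and changing cost temporal orienteering -/

/-- A temporal cost graph with `n` vertices and `T` time steps: a static graph together with a cost
`F(u, v, t₁, t₂)` in `ℕ ∪ {∞}`, for start vertex `u`, destination `v`, departure time `t₁` and
arrival time `t₂`. All costs of moves between distinct vertices are positive (integers or
infinite); staying at a vertex is free. -/
structure TemporalCostGraph (n T : ℕ) where
  graph : SimpleGraph (Fin n)
  cost : Fin n → Fin n → Fin T → Fin T → ℕ∞
  cost_eq_top : ∀ u v t₁ t₂, t₂ ≤ t₁ → cost u v t₁ t₂ = ⊤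
  cost_self : ∀ v t₁ t₂, t₁ < t₂ → cost v v t₁ t₂ = 0
  cost_pos : ∀ u v t₁ t₂, u ≠ v → 0 < cost u v t₁ t₂

namespace TemporalCostGraph

/-- A quadruple `(u, v, t, t')`: leave `u` at time `t` and arrive at `v` at time `t'`. -/
structure Move (n T : ℕ) where
  src : Fin n
  dst : Fin n
  dep : Fin T
  arr : Fin T

variable {n T : ℕ}

/-- The cost of a single move. -/
def moveCost (G : TemporalCostGraph n T) (m : Move n T) : ℕ∞ :=
  G.cost m.src m.dst m.dep m.arr

/-- Valid walks. -/
def IsValidWalk (G : TemporalCostGraph n T) (W : List (Move n T)) : Prop :=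
  (∀ m ∈ W, m.dep < m.arr ∧ G.moveCost m < ⊤) ∧
    W.IsChain fun m m' => m.dst = m'.src ∧ m.arr ≤ m'.dep

/-- The cost of a walk. -/
def walkCost (G : TemporalCostGraph n T) (W : List (Move n T)) : ℕ∞ :=
  (W.map G.moveCost).sum

/-- The walk `W` leads from `s` to `t`; the trivial walk leads from each vertex to itself. -/
def Joins (s t : Fin n) (W : List (Move n T)) : Prop :=
  (W = [] ∧ s = t) ∨ (W.head?.map Move.src = some s ∧ W.getLast?.map Move.dst = some t)

/-- The vertices visited by a walk that starts at `s`; the trivial walk visits only `s`. -/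
def visited (s : Fin n) (W : List (Move n T)) : Finset (Fin n) :=
  insert s (W.map Move.src ++ W.map Move.dst).toFinset

end TemporalCostGraph

/-- Instances of Changing Cost Temporal Orienteering. -/
structure CCTOInstance where
  /-- The number of vertices. -/
  n : ℕ
  /-- The number of time steps. -/
  T : ℕ
  G : TemporalCostGraph n T
  source : Fin n
  sink : Fin n
  /-- The number of distinct vertices to be visited. -/
  target : ℕ
  /-- The fuel budget. -/
  budget : ℕ

namespace CCTOInstance

open TemporalCostGraph

/-- The question of Changing Cost Temporal Orienteering: is there a valid walk from the source to
the sink that visits at least `target` distinct vertices and has cost at most `budget`? -/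
def IsYes (x : CCTOInstance) : Prop :=
  ∃ W : List (Move x.n x.T), x.G.IsValidWalk W ∧ Joins x.source x.sink W ∧
    x.target ≤ (visited x.source W).card ∧ x.G.walkCost W ≤ x.budget

/-- The code of a cost: `0` stands for `∞`, and `c + 1` for the finite cost `c`. -/
noncomputable def costCode (c : ℕ∞) : ℕ :=
  if c = ⊤ then 0 else c.toNat + 1

/-- The adjacency matrix of the static graph, row by row. -/
noncomputable def graphCode (x : CCTOInstance) : List ℕ :=
  open Classical in
  (List.finRange x.n).flatMap fun u => (List.finRange x.n).map fun v =>
    if x.G.graph.Adj u v then 1 else 0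

/-- The table of all costs `F(u, v, t₁, t₂)`, in lexicographic order of `(u, v, t₁, t₂)`. -/
noncomputable def costTable (x : CCTOInstance) : List ℕ :=
  (List.finRange x.n).flatMap fun u => (List.finRange x.n).flatMap fun v =>
    (List.finRange x.T).flatMap fun t₁ => (List.finRange x.T).map fun t₂ =>
      costCode (x.G.cost u v t₁ t₂)

/-- The input word of an instance: the numbers `n`, `T`, source, sink, target and budget, then the
static graph, then the cost table. -/
noncomputable def encode (x : CCTOInstance) : List ℕ :=
  [x.n, x.T, x.source, x.sink, x.target, x.budget] ++ x.graphCode ++ x.costTable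

end CCTOInstance

/-!
A walk of cost at most `f` visits at most `f + 1` vertices (`card_visited_le`), because only waiting
is free. So the target `k` can be assumed to be at most `f + 1`, and colour coding applies. Label the
vertices by numbers below `K = (f + 1) ^ 2`. If `k` visited vertices have different labels, then the
walk is found by dynamic programming over the set of labels met so far, the current vertex and the
time: the least cost of reaching such a state is computed by relaxing all moves in the order of
their departure. There are `2 ^ K * n * (T + 1)` states. Conversely, a walk that meets at least `k`
labels visits at least `k` vertices, for whatever labels (`Reveals.isYes`).

Labels are chosen from a family of about `4 * n ^ 2` functions `v ↦ (a * v % p) % K`. By Bertrand's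
postulate, some modulus `p ≤ 2 * n` is a prime greater than `n`. For this modulus, each pair of vertices
gets the same label for at most a fraction of `2 / K` of the factors `a`, and since there are fewer than
`K / 2` pairs among `k` vertices, some `a` separates all of them (`Nat.exists_injOn_hash`). The program
need not know which moduli are primes, because it tries all of them and no labels can lead to a wrong
answer.

Running times are read off from the shape of the program. `Prog.Ensures B p σ Q` says that `p` halts
after at most `weight * (B + 1) ^ depth` steps in a state that satisfies `Q`, where `B` bounds the
numbers of passes of all loops. Here `B` is at most `8 * 2 ^ K` times the square of the input size
(`loopBound_add_one_le`). Arithmetic beyond the instructions of the machine is provided by `Term`,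
whose compiler uses the registers as a stack.
-/

/-! ### Total correctness with a time bound -/

namespace RAM

/-- The nesting depth of the loops of a program. -/
def Prog.depth : Prog → ℕ
  | .skip => 0
  | .assign _ _ => 0
  | .store _ _ => 0
  | .seq p q => max p.depth q.depth
  | .ite _ p q => max p.depth q.depth
  | .loop _ p => p.depth + 1

/-- The number of steps of a program in which each loop body is run once and both branches of each
conditional are run. -/
def Prog.weight : Prog → ℕ
  | .skip => 1
  | .assign _ a => a.steps + 1
  | .store a b => a.steps + b.steps + 1
  | .seq p q => p.weight + q.weight
  | .ite c p q => c.steps + 1 + p.weight + q.weight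
  | .loop c p => c.steps + 1 + p.weight

/-- The program `p` assigns only to registers from `L` on. -/
def Prog.Above (L : ℕ) : Prog → Prop
  | .skip => True
  | .assign x _ => L ≤ x
  | .store _ _ => True
  | .seq p q => p.Above L ∧ q.Above L
  | .ite _ p q => p.Above L ∧ q.Above L
  | .loop _ p => p.Above L

/-- Started in `σ`, the program `p` halts in a state that satisfies `Q`. The number of steps is what
the shape of `p` yields if no loop is run through more than `B` times. -/
def Prog.Ensures (B : ℕ) (p : Prog) (σ : State) (Q : State → Prop) : Prop :=
  ∃ t τ, Exec p σ t τ ∧ t ≤ p.weight * (B + 1) ^ p.depth ∧ Q τ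

theorem Exec.reg_eq_of_above {p : Prog} {σ τ : State} {t L x : ℕ} (h : Exec p σ t τ)
    (hp : p.Above L) (hx : x < L) : τ.reg x = σ.reg x := by
  induction h with
  | skip | store => rfl
  | assign y a σ =>
    have hy : L ≤ y := hp
    simp [show x ≠ y by omega]
  | seq _ _ ih₁ ih₂ => rw [ih₂ hp.2, ih₁ hp.1]
  | ite_true _ _ ih => exact ih hp.1
  | ite_false _ _ ih => exact ih hp.2
  | loop_true _ _ _ ih₁ ih₂ => rw [ih₂ hp, ih₁ hp]
  | loop_false => rfl

theorem Prog.Above.mono {p : Prog} {L M : ℕ} (h : p.Above L) (hML : M ≤ L) : p.Above M := by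
  induction p with
  | skip | store => trivial
  | assign x a => exact le_trans hML h
  | seq p q ihp ihq | ite _ p q ihp ihq => exact ⟨ihp h.1, ihq h.2⟩
  | loop c p ih => exact ih h

namespace Prog.Ensures

variable {B : ℕ} {p q : Prog} {σ : State} {Q R : State → Prop}

theorem mono (h : p.Ensures B σ Q) (hQR : ∀ τ, Q τ → R τ) : p.Ensures B σ R := by
  obtain ⟨t, τ, he, ht, hq⟩ := h
  exact ⟨t, τ, he, ht, hQR τ hq⟩

/-- The frame rule: registers that are not assigned to keep their values. -/
theorem frame {L : ℕ} (h : p.Ensures B σ Q) (hp : p.Above L) :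
    p.Ensures B σ fun τ => Q τ ∧ ∀ x < L, τ.reg x = σ.reg x := by
  obtain ⟨t, τ, he, ht, hq⟩ := h
  exact ⟨t, τ, he, ht, hq, fun x hx => he.reg_eq_of_above hp hx⟩

theorem skip (h : Q σ) : Prog.skip.Ensures B σ Q :=
  ⟨1, σ, .skip σ, by simp [Prog.weight, Prog.depth], h⟩

theorem assign {x : ℕ} {a : Expr} (h : Q ⟨Function.update σ.reg x (a.eval σ), σ.mem⟩) :
    (Prog.assign x a).Ensures B σ Q :=
  ⟨_, _, .assign x a σ, by simp [Prog.weight, Prog.depth], h⟩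

theorem store {a b : Expr} (h : Q ⟨σ.reg, Function.update σ.mem (a.eval σ) (b.eval σ)⟩) :
    (Prog.store a b).Ensures B σ Q :=
  ⟨_, _, .store a b σ, by simp [Prog.weight, Prog.depth], h⟩

theorem seq (h : p.Ensures B σ fun τ => q.Ensures B τ Q) : (p.seq q).Ensures B σ Q := by
  obtain ⟨s, τ, he, hs, t, ρ, he', ht, hq⟩ := h
  refine ⟨s + t, ρ, .seq he he', ?_, hq⟩
  have h₁ : (B + 1) ^ p.depth ≤ (B + 1) ^ (p.seq q).depth :=
    Nat.pow_le_pow_right (by omega) (le_max_left _ _)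
  have h₂ : (B + 1) ^ q.depth ≤ (B + 1) ^ (p.seq q).depth :=
    Nat.pow_le_pow_right (by omega) (le_max_right _ _)
  calc s + t ≤ p.weight * (B + 1) ^ (p.seq q).depth + q.weight * (B + 1) ^ (p.seq q).depth :=
        add_le_add (hs.trans (Nat.mul_le_mul_left _ h₁)) (ht.trans (Nat.mul_le_mul_left _ h₂))
    _ = _ := by rw [← add_mul]; rfl

theorem ite {c : Expr} (h₁ : c.eval σ ≠ 0 → p.Ensures B σ Q)
    (h₂ : c.eval σ = 0 → q.Ensures B σ Q) : (Prog.ite c p q).Ensures B σ Q := by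
  have hd : 1 ≤ (B + 1) ^ (Prog.ite c p q).depth := Nat.one_le_pow _ _ (by omega)
  by_cases hc : c.eval σ = 0
  · obtain ⟨t, τ, he, ht, hq⟩ := h₂ hc
    refine ⟨_, τ, .ite_false hc he, ?_, hq⟩
    have h : (B + 1) ^ q.depth ≤ (B + 1) ^ (Prog.ite c p q).depth :=
      Nat.pow_le_pow_right (by omega) (le_max_right _ _)
    have := ht.trans (Nat.mul_le_mul_left _ h)
    simp only [Prog.weight, add_mul] at this ⊢
    nlinarith
  · obtain ⟨t, τ, he, ht, hq⟩ := h₁ hc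
    refine ⟨_, τ, .ite_true hc he, ?_, hq⟩
    have h : (B + 1) ^ p.depth ≤ (B + 1) ^ (Prog.ite c p q).depth :=
      Nat.pow_le_pow_right (by omega) (le_max_left _ _)
    have := ht.trans (Nat.mul_le_mul_left _ h)
    simp only [Prog.weight, add_mul] at this ⊢
    nlinarith

end Prog.Ensures

/-- Run `body` with the register `x` counting from `0` up to, but not including, the value of the
register `y`. -/
def forLoop (x y : ℕ) (body : Prog) : Prog :=
  .seq (.assign x (.const 0)) (.loop (.sub (.reg y) (.reg x))
    (.seq body (.assign x (.add (.reg x) (.const 1)))))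

namespace Prog.Ensures

variable {B : ℕ} {Q : State → Prop}

theorem forLoop {x y N : ℕ} {body : Prog} {σ₀ : State} (I : ℕ → State → Prop)
    (hxy : x ≠ y) (hN : σ₀.reg y = N) (hB : N ≤ B)
    (h0 : I 0 ⟨Function.update σ₀.reg x 0, σ₀.mem⟩)
    (hstep : ∀ i < N, ∀ σ, I i σ → σ.reg x = i → σ.reg y = N → body.Ensures B σ fun τ =>
      τ.reg x = i ∧ τ.reg y = N ∧ I (i + 1) ⟨Function.update τ.reg x (i + 1), τ.mem⟩) :
    (RAM.forLoop x y body).Ensures B σ₀ fun τ => I N τ := by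
  set c : Expr := .sub (.reg y) (.reg x) with hc
  set b : Prog := .seq body (.assign x (.add (.reg x) (.const 1))) with hb
  have key : ∀ m i σ, i + m = N → I i σ → σ.reg x = i → σ.reg y = N →
      ∃ t τ, Exec (.loop c b) σ t τ ∧
        t ≤ (m + 1) * (c.steps + 1 + b.weight * (B + 1) ^ b.depth) ∧ I N τ := by
    intro m
    induction m with
    | zero =>
      intro i σ hi hI hx hy
      refine ⟨_, σ, .loop_false ?_, ?_, by simpa [← hi] using hI⟩
      · simp [hc, Expr.eval, hx, hy, ← hi]
      · omega
    | succ m ih =>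
      intro i σ hi hI hx hy
      have hbody : b.Ensures B σ fun τ =>
          τ.reg x = i + 1 ∧ τ.reg y = N ∧ I (i + 1) τ := by
        refine Ensures.seq ((hstep i (by omega) σ hI hx hy).mono ?_)
        rintro τ ⟨h₁, h₂, h₃⟩
        refine Ensures.assign ?_
        simp only [Expr.eval, h₁]
        exact ⟨by simp, by simp [hxy.symm, h₂], h₃⟩
      obtain ⟨s, τ, he, hs, hτx, hτy, hτ⟩ := hbody
      obtain ⟨t, ρ, he', ht, hρ⟩ := ih (i + 1) τ (by omega) hτ hτx hτy
      refine ⟨_, ρ, .loop_true ?_ he he', ?_, hρ⟩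
      · simp only [hc, Expr.eval, hx, hy]; omega
      · have : (m + 1 + 1) * (c.steps + 1 + b.weight * (B + 1) ^ b.depth) =
          (m + 1) * (c.steps + 1 + b.weight * (B + 1) ^ b.depth) +
          (c.steps + 1 + b.weight * (B + 1) ^ b.depth) := by ring
        omega
  refine Ensures.seq (Ensures.assign ?_)
  obtain ⟨t, τ, he, ht, hτ⟩ := key N 0 ⟨Function.update σ₀.reg x 0, σ₀.mem⟩ (by omega) h0
    (by simp) (by simp [hxy.symm, hN])
  refine ⟨t, τ, he, ht.trans ?_, hτ⟩
  have h1 : 1 ≤ (B + 1) ^ b.depth := Nat.one_le_pow _ _ (by omega)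
  calc (N + 1) * (c.steps + 1 + b.weight * (B + 1) ^ b.depth)
      ≤ (B + 1) * ((c.steps + 1) * (B + 1) ^ b.depth + b.weight * (B + 1) ^ b.depth) := by
        gcongr
        exact Nat.le_mul_of_pos_right _ h1
    _ = (Prog.loop c b).weight * (B + 1) ^ (Prog.loop c b).depth := by
        simp only [Prog.weight, Prog.depth]; ring

/-- The rule for a loop that deals with the items `0, …, N - 1` one by one. All that matters is the
memory: `J` is kept throughout, the memory only improves in the sense of the preorder `R`, the pass
for the item `i` achieves `P i`, and this is not undone by an improvement. -/
theorem forEach {x y N : ℕ} {body : Prog} {σ₀ : State} (J : (ℕ → ℕ) → Prop)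
    (R : (ℕ → ℕ) → (ℕ → ℕ) → Prop) (P : ℕ → (ℕ → ℕ) → Prop)
    (hR : ∀ m, R m m) (hR' : ∀ m₁ m₂ m₃, R m₁ m₂ → R m₂ m₃ → R m₁ m₃)
    (hP : ∀ i m₁ m₂, R m₁ m₂ → P i m₁ → P i m₂)
    (hyx : y < x) (habove : body.Above (x + 1)) (hN : σ₀.reg y = N) (hB : N ≤ B)
    (hJ : J σ₀.mem)
    (hstep : ∀ i < N, ∀ σ, (∀ z < x, σ.reg z = σ₀.reg z) → σ.reg x = i → J σ.mem →
      (∀ j < i, P j σ.mem) → body.Ensures B σ fun τ => J τ.mem ∧ R σ.mem τ.mem ∧ P i τ.mem) :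
    (RAM.forLoop x y body).Ensures B σ₀ fun τ =>
      J τ.mem ∧ R σ₀.mem τ.mem ∧ ∀ i < N, P i τ.mem := by
  refine (Ensures.forLoop (fun i σ => (∀ z < x, σ.reg z = σ₀.reg z) ∧ J σ.mem ∧ R σ₀.mem σ.mem ∧
    ∀ j < i, P j σ.mem) (by omega) hN hB ?_ ?_).mono fun τ h => h.2
  · refine ⟨fun z hz => ?_, hJ, hR _, by simp⟩
    simp [hz.ne]
  · rintro i hi σ ⟨hreg, hJσ, hRσ, hPσ⟩ hx hy
    refine ((hstep i hi σ hreg hx hJσ hPσ).frame habove).mono ?_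
    rintro τ ⟨⟨h₁, h₂, h₃⟩, hτ⟩
    refine ⟨by rw [hτ x (by omega), hx], by rw [hτ y (by omega), hy], fun z hz => ?_, h₁,
      hR' _ _ _ hRσ h₂, fun j hj => ?_⟩
    · simp [hz.ne, hτ z (by omega), hreg z hz]
    · rcases Nat.lt_succ_iff_lt_or_eq.1 hj with hj | rfl
      · exact hP _ _ _ h₂ (hPσ j hj)
      · exact h₃

end Prog.Ensures

theorem forLoop_above {x y L : ℕ} {body : Prog} (hx : L ≤ x) (h : body.Above L) :
    (forLoop x y body).Above L := ⟨hx, h, hx⟩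

/-! ### Terms with multiplication and bit operations -/

/-- Binary operations that are computed by iteration. The number of passes is the value of the first
operand. -/
inductive Op where
  | mul
  | mod
  | pow
  | shift
  | count

/-- The function computed by an operation: `a * b`, `a % b`, `2 ^ a`, `b / 2 ^ a`, and the number of
ones among the last `a` binary digits of `b`. -/
def Op.fn : Op → ℕ → ℕ → ℕ
  | .mul, a, b => a * b
  | .mod, a, b => a % b
  | .pow, a, _ => 2 ^ a
  | .shift, a, b => b / 2 ^ a
  | .count, a, b => ∑ i ∈ Finset.range a, b / 2 ^ i % 2

/-- The value of the accumulator after `i` passes. -/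
def Op.acc : Op → ℕ → ℕ → ℕ → ℕ
  | .mul, _, b, i => i * b
  | .mod, a, b, i => a - min i (a / b) * b
  | .pow, _, _, i => 2 ^ i
  | .shift, _, b, i => b / 2 ^ i
  | .count, _, b, i => ∑ j ∈ Finset.range i, b / 2 ^ j % 2

/-- The value of the second operand after `i` passes. -/
def Op.arg : Op → ℕ → ℕ → ℕ
  | .count, b, i => b / 2 ^ i
  | _, b, _ => b

/-- The initial value of the accumulator; the operands are in the registers `d` and `d + 1`. -/
def Op.initExpr (d : ℕ) : Op → Expr
  | .mul => .const 0
  | .mod => .reg d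
  | .pow => .const 1
  | .shift => .reg (d + 1)
  | .count => .const 0

/-- A pass of the iteration, with the second operand in the register `d + 1` and the accumulator in
the register `d + 2`. -/
def Op.stepProg (d : ℕ) : Op → Prog
  | .mul => .assign (d + 2) (.add (.reg (d + 2)) (.reg (d + 1)))
  | .mod => .ite (.sub (.add (.reg (d + 2)) (.const 1)) (.reg (d + 1)))
      (.assign (d + 2) (.sub (.reg (d + 2)) (.reg (d + 1)))) .skip
  | .pow => .assign (d + 2) (.add (.reg (d + 2)) (.reg (d + 2)))
  | .shift => .assign (d + 2) (.half (.reg (d + 2)))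
  | .count => .seq
      (.assign (d + 2) (.add (.reg (d + 2))
        (.sub (.reg (d + 1)) (.add (.half (.reg (d + 1))) (.half (.reg (d + 1)))))))
      (.assign (d + 1) (.half (.reg (d + 1))))

/-- The program for an operation on the values of the registers `d` and `d + 1`, with the result in
the register `d`. -/
def Op.prog (d : ℕ) (o : Op) : Prog :=
  .seq (.assign (d + 2) (o.initExpr d))
    (.seq (forLoop (d + 3) d (o.stepProg d)) (.assign d (.reg (d + 2))))

theorem Op.acc_self (o : Op) (a b : ℕ) : o.acc a b a = o.fn a b := by
  cases o <;> try rfl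
  simp only [Op.acc, Op.fn, min_eq_right (Nat.div_le_self a b), Nat.mod_eq_sub_div_mul]

theorem Op.stepProg_above (d : ℕ) (o : Op) : (o.stepProg d).Above (d + 1) := by
  cases o <;> simp [Op.stepProg, Prog.Above]

theorem Op.prog_above (d : ℕ) (o : Op) : (o.prog d).Above d :=
  ⟨Nat.le_add_right d 2, forLoop_above (by omega) ((o.stepProg_above d).mono (by omega)), le_rfl⟩

theorem Op.stepProg_ensures {B : ℕ} {σ : State} {a b d i : ℕ} (o : Op)
    (hb : σ.reg (d + 1) = o.arg b i) (hacc : σ.reg (d + 2) = o.acc a b i) :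
    (o.stepProg d).Ensures B σ fun τ => τ.mem = σ.mem ∧ τ.reg (d + 3) = σ.reg (d + 3) ∧
      τ.reg (d + 1) = o.arg b (i + 1) ∧ τ.reg (d + 2) = o.acc a b (i + 1) := by
  cases o with
  | mul =>
    refine Prog.Ensures.assign ?_
    simp_all [Expr.eval, Op.acc, Op.arg, add_mul]
  | mod =>
    have hdiv : a / b * b ≤ a := Nat.div_mul_le_self a b
    simp only [Op.acc, Op.arg] at hb hacc
    refine Prog.Ensures.ite (fun h => Prog.Ensures.assign ?_) (fun h => Prog.Ensures.skip ?_) <;>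
      simp only [Expr.eval, hb, hacc] at h ⊢
    -- For `b = 0`, the subtraction of `b` has no effect, in accordance with `a / 0 = 0`.
    · rcases Nat.eq_zero_or_pos b with rfl | hbpos
      · simp [Op.acc, Op.arg, hb]
      have hlt : i < a / b := by
        by_contra hcon
        rw [min_eq_right (by omega)] at h
        have := Nat.div_add_mod' a b
        have := Nat.mod_lt a hbpos
        omega
      simp only [Op.acc, Op.arg]
      rw [min_eq_left hlt.le, min_eq_left hlt]
      simp [hb, add_mul, Nat.sub_sub]
    · simp only [Op.acc, Op.arg]
      refine ⟨trivial, trivial, trivial, ?_⟩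
      have hle : a / b ≤ i := by
        by_contra hcon
        rw [min_eq_left (by omega)] at h
        have : (i + 1) * b ≤ a / b * b := Nat.mul_le_mul_right _ (by omega)
        rw [add_mul, one_mul] at this
        omega
      rw [min_eq_right hle, min_eq_right (by omega)]
  | pow =>
    refine Prog.Ensures.assign ?_
    simp_all [Expr.eval, Op.acc, Op.arg, pow_succ, mul_two]
  | shift =>
    refine Prog.Ensures.assign ?_
    simp_all [Expr.eval, Op.acc, Op.arg, pow_succ, Nat.div_div_eq_div_mul]
  | count =>
    refine Prog.Ensures.seq (Prog.Ensures.assign (Prog.Ensures.assign ?_))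
    simp only [Op.acc, Op.arg] at hb hacc
    refine ⟨rfl, by simp, ?_, ?_⟩
    · simp [Expr.eval, hb, Op.arg, pow_succ, Nat.div_div_eq_div_mul]
    · simp [Expr.eval, hb, hacc, Op.acc, Finset.sum_range_succ]
      omega

theorem Op.prog_ensures {B : ℕ} {σ : State} {a b d : ℕ} (o : Op) (ha : σ.reg d = a)
    (hb : σ.reg (d + 1) = b) (hB : a ≤ B) :
    (o.prog d).Ensures B σ fun τ =>
      τ.mem = σ.mem ∧ τ.reg d = o.fn a b ∧ ∀ x < d, τ.reg x = σ.reg x := by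
  have hmain : (o.prog d).Ensures B σ fun τ => τ.mem = σ.mem ∧ τ.reg d = o.fn a b := by
    refine .seq (.assign (.seq ((Prog.Ensures.forLoop (fun i τ => τ.mem = σ.mem ∧
      τ.reg (d + 1) = o.arg b i ∧ τ.reg (d + 2) = o.acc a b i) (N := a) (by omega) ?_ hB ?_
      ?_).mono ?_)))
    · simp [ha]
    · refine ⟨rfl, ?_, ?_⟩ <;>
      cases o <;> simp [ha, hb, Op.arg, Op.acc, Op.initExpr, Expr.eval]
    · rintro i - τ ⟨hm, h₁, h₂⟩ hx hy
      refine ((o.stepProg_ensures h₁ h₂).frame (o.stepProg_above d)).mono ?_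
      rintro ρ ⟨⟨h₃, h₄, h₅, h₆⟩, h₇⟩
      refine ⟨by rw [h₄, hx], by rw [h₇ d (by omega), hy], by rw [← hm, ← h₃], ?_, ?_⟩
      · simp [h₅]
      · simp [h₆]
    · rintro τ ⟨hm, -, h₂⟩
      refine .assign ⟨hm, ?_⟩
      simp [Expr.eval, h₂, Op.acc_self]
  refine (hmain.frame (o.prog_above d)).mono ?_
  rintro τ ⟨⟨h₁, h₂⟩, h₃⟩
  exact ⟨h₁, h₂, h₃⟩

/-- Expressions enriched by the operations `Op` and by a conditional. -/
inductive Term where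
  | const (c : ℕ)
  | reg (x : ℕ)
  | load (a : Term)
  | add (a b : Term)
  | sub (a b : Term)
  | op (o : Op) (a b : Term)
  | ite (c a b : Term)

namespace Term

/-- The value of a term in a state. -/
def eval (σ : State) : Term → ℕ
  | .const c => c
  | .reg x => σ.reg x
  | .load a => σ.mem (a.eval σ)
  | .add a b => a.eval σ + b.eval σ
  | .sub a b => a.eval σ - b.eval σ
  | .op o a b => o.fn (a.eval σ) (b.eval σ)
  | .ite c a b => if c.eval σ ≠ 0 then a.eval σ else b.eval σ

/-- The term reads only registers below `d`. -/
def Below (d : ℕ) : Term → Prop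
  | .const _ => True
  | .reg x => x < d
  | .load a => a.Below d
  | .add a b => a.Below d ∧ b.Below d
  | .sub a b => a.Below d ∧ b.Below d
  | .op _ a b => a.Below d ∧ b.Below d
  | .ite c a b => c.Below d ∧ a.Below d ∧ b.Below d

/-- In the evaluation of the term, no operation needs more than `B` passes. -/
def Bounded (B : ℕ) (σ : State) : Term → Prop
  | .const _ => True
  | .reg _ => True
  | .load a => a.Bounded B σ
  | .add a b => a.Bounded B σ ∧ b.Bounded B σ
  | .sub a b => a.Bounded B σ ∧ b.Bounded B σ
  | .op _ a b => a.eval σ ≤ B ∧ a.Bounded B σ ∧ b.Bounded B σ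
  | .ite c a b => c.Bounded B σ ∧ a.Bounded B σ ∧ b.Bounded B σ

/-- The program that leaves the value of a term in the register `d` and assigns to no register
below `d`. -/
def prog : Term → ℕ → Prog
  | .const c, d => .assign d (.const c)
  | .reg x, d => .assign d (.reg x)
  | .load a, d => .seq (a.prog d) (.assign d (.load (.reg d)))
  | .add a b, d => .seq (a.prog d) (.seq (b.prog (d + 1))
      (.assign d (.add (.reg d) (.reg (d + 1)))))
  | .sub a b, d => .seq (a.prog d) (.seq (b.prog (d + 1))
      (.assign d (.sub (.reg d) (.reg (d + 1)))))
  | .op o a b, d => .seq (a.prog d) (.seq (b.prog (d + 1)) (o.prog d))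
  | .ite c a b, d => .seq (c.prog d) (.ite (.reg d) (a.prog d) (b.prog d))

theorem Below.mono {e : Term} {d d' : ℕ} (h : e.Below d) (hd : d ≤ d') : e.Below d' := by
  induction e with
  | const => trivial
  | reg x => exact lt_of_lt_of_le h hd
  | load a ih => exact ih h
  | add a b iha ihb | sub a b iha ihb | op _ a b iha ihb => exact ⟨iha h.1, ihb h.2⟩
  | ite c a b ihc iha ihb => exact ⟨ihc h.1, iha h.2.1, ihb h.2.2⟩

theorem eval_congr {e : Term} {d : ℕ} {σ τ : State} (h : e.Below d) (hm : τ.mem = σ.mem)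
    (hr : ∀ x < d, τ.reg x = σ.reg x) : e.eval τ = e.eval σ := by
  induction e with
  | const => rfl
  | reg x => exact hr x h
  | load a ih => simp [eval, ih h, hm]
  | add a b iha ihb | sub a b iha ihb | op _ a b iha ihb => simp [eval, iha h.1, ihb h.2]
  | ite c a b ihc iha ihb => simp [eval, ihc h.1, iha h.2.1, ihb h.2.2]

theorem Bounded.congr {e : Term} {B d : ℕ} {σ τ : State} (hB : e.Bounded B σ) (h : e.Below d)
    (hm : τ.mem = σ.mem) (hr : ∀ x < d, τ.reg x = σ.reg x) : e.Bounded B τ := by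
  induction e with
  | const | reg => trivial
  | load a ih => exact ih hB h
  | add a b iha ihb | sub a b iha ihb => exact ⟨iha hB.1 h.1, ihb hB.2 h.2⟩
  | op _ a b iha ihb =>
    exact ⟨by rw [eval_congr h.1 hm hr]; exact hB.1, iha hB.2.1 h.1, ihb hB.2.2 h.2⟩
  | ite c a b ihc iha ihb => exact ⟨ihc hB.1 h.1, iha hB.2.1 h.2.1, ihb hB.2.2 h.2.2⟩

theorem prog_above (e : Term) (d : ℕ) : (e.prog d).Above d := by
  induction e generalizing d with
  | const | reg => exact le_rfl
  | load a ih => exact ⟨ih d, le_rfl⟩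
  | add a b iha ihb | sub a b iha ihb => exact ⟨iha d, (ihb (d + 1)).mono (by omega), le_rfl⟩
  | op o a b iha ihb => exact ⟨iha d, (ihb (d + 1)).mono (by omega), o.prog_above d⟩
  | ite c a b ihc iha ihb => exact ⟨ihc d, iha d, ihb d⟩

/-- The common part of all binary operations: the second operand is computed in a state in which the
first one is stored, which does not affect its value. -/
theorem prog_ensures_aux {B d : ℕ} {σ : State} {a b : Term} {p : Prog} {Q : State → Prop}
    (iha : (a.prog d).Ensures B σ fun τ =>
      τ.mem = σ.mem ∧ τ.reg d = a.eval σ ∧ ∀ x < d, τ.reg x = σ.reg x)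
    (ihb : ∀ τ, b.Bounded B τ → (b.prog (d + 1)).Ensures B τ fun ρ =>
      ρ.mem = τ.mem ∧ ρ.reg (d + 1) = b.eval τ ∧ ∀ x < d + 1, ρ.reg x = τ.reg x)
    (hb : b.Below d) (hB : b.Bounded B σ)
    (hp : ∀ τ, τ.mem = σ.mem → τ.reg d = a.eval σ → τ.reg (d + 1) = b.eval σ →
      (∀ x < d, τ.reg x = σ.reg x) → p.Ensures B τ Q) :
    (Prog.seq (a.prog d) (.seq (b.prog (d + 1)) p)).Ensures B σ Q := by
  refine .seq (iha.mono ?_)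
  rintro τ ⟨hm, hd, hr⟩
  refine .seq ((ihb τ (hB.congr hb hm hr)).mono ?_)
  rintro ρ ⟨hm', hd', hr'⟩
  refine hp ρ (hm'.trans hm) ((hr' d (by omega)).trans hd) ?_ fun x hx => ?_
  · rw [hd', eval_congr hb hm hr]
  · rw [hr' x (by omega), hr x hx]

theorem prog_ensures {B d : ℕ} {σ : State} (e : Term) (h : e.Below d) (hB : e.Bounded B σ) :
    (e.prog d).Ensures B σ fun τ =>
      τ.mem = σ.mem ∧ τ.reg d = e.eval σ ∧ ∀ x < d, τ.reg x = σ.reg x := by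
  induction e generalizing d σ with
  | const c =>
    exact .assign ⟨rfl, by simp [Expr.eval, eval],
      fun x hx => by simp [hx.ne]⟩
  | reg y =>
    exact .assign ⟨rfl, by simp [Expr.eval, eval],
      fun x hx => by simp [hx.ne]⟩
  | load a ih =>
    refine .seq ((ih h hB).mono ?_)
    rintro τ ⟨hm, hd, hr⟩
    exact .assign ⟨hm, by simp [Expr.eval, eval, hd, hm],
      fun x hx => by simp [hx.ne, hr x hx]⟩
  | add a b iha ihb =>
    refine prog_ensures_aux (iha h.1 hB.1) (fun τ hτ => ihb (h.2.mono (by omega)) hτ) h.2 hB.2 ?_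
    intro τ hm ha hb hr
    exact .assign ⟨hm, by simp [Expr.eval, eval, ha, hb],
      fun x hx => by simp [hx.ne, hr x hx]⟩
  | sub a b iha ihb =>
    refine prog_ensures_aux (iha h.1 hB.1) (fun τ hτ => ihb (h.2.mono (by omega)) hτ) h.2 hB.2 ?_
    intro τ hm ha hb hr
    exact .assign ⟨hm, by simp [Expr.eval, eval, ha, hb],
      fun x hx => by simp [hx.ne, hr x hx]⟩
  | op o a b iha ihb =>
    refine prog_ensures_aux (iha h.1 hB.2.1) (fun τ hτ => ihb (h.2.mono (by omega)) hτ) h.2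
      hB.2.2 ?_
    intro τ hm ha hb hr
    refine (o.prog_ensures ha hb hB.1).mono ?_
    rintro ρ ⟨hm', hd, hr'⟩
    exact ⟨hm'.trans hm, hd, fun x hx => by rw [hr' x hx, hr x hx]⟩
  | ite c a b ihc iha ihb =>
    refine .seq ((ihc h.1 hB.1).mono ?_)
    rintro τ ⟨hm, hd, hr⟩
    refine .ite (fun hc => ?_) (fun hc => ?_)
    · refine (iha h.2.1 (hB.2.1.congr h.2.1 hm hr)).mono ?_
      rintro ρ ⟨hm', hd', hr'⟩
      refine ⟨hm'.trans hm, ?_, fun x hx => by rw [hr' x hx, hr x hx]⟩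
      simp only [Expr.eval, hd] at hc
      rw [hd', eval_congr h.2.1 hm hr, eval, if_pos hc]
    · refine (ihb h.2.2 (hB.2.2.congr h.2.2 hm hr)).mono ?_
      rintro ρ ⟨hm', hd', hr'⟩
      refine ⟨hm'.trans hm, ?_, fun x hx => by rw [hr' x hx, hr x hx]⟩
      simp only [Expr.eval, hd] at hc
      rw [hd', eval_congr h.2.2 hm hr, eval, if_neg (by simpa using hc)]

/-- Store the value of the term `e` at the address given by the term `a`. -/
def storeProg (d : ℕ) (a e : Term) : Prog :=
  .seq (a.prog d) (.seq (e.prog (d + 1)) (.store (.reg d) (.reg (d + 1))))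

theorem storeProg_above (d : ℕ) (a e : Term) : (storeProg d a e).Above d :=
  ⟨a.prog_above d, (e.prog_above (d + 1)).mono (by omega), trivial⟩

theorem storeProg_ensures {B d : ℕ} {σ : State} {a e : Term} (ha : a.Below d) (he : e.Below d)
    (hBa : a.Bounded B σ) (hBe : e.Bounded B σ) :
    (storeProg d a e).Ensures B σ fun τ =>
      τ.mem = Function.update σ.mem (a.eval σ) (e.eval σ) := by
  refine prog_ensures_aux (a.prog_ensures ha hBa)
    (fun τ hτ => e.prog_ensures (he.mono (by omega)) hτ) he hBe ?_
  intro τ hm hd hd' hr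
  refine .store ?_
  simp [Expr.eval, hd, hd', hm]

end Term

end RAM

/-! ### Walks and label sets -/

theorem Nat.or_two_pow_eq_self {q j : ℕ} (hq : q.testBit j) : q ||| 2 ^ j = q := by
  refine Nat.eq_of_testBit_eq fun i => ?_
  rw [Nat.testBit_or, Nat.testBit_two_pow]
  by_cases hij : j = i
  · simp [hij ▸ hq]
  · simp [hij]

namespace TemporalCostGraph

variable {n T : ℕ} {G : TemporalCostGraph n T} {s u v : Fin n} {W : List (Move n T)} {m : Move n T}

theorem isValidWalk_concat : G.IsValidWalk (W ++ [m]) ↔ G.IsValidWalk W ∧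
    (m.dep < m.arr ∧ G.moveCost m < ⊤) ∧ ∀ l ∈ W.getLast?, l.dst = m.src ∧ l.arr ≤ m.dep := by
  simp only [IsValidWalk, List.isChain_append, List.mem_append, List.mem_singleton]
  constructor
  · rintro ⟨h₁, h₂, -, h₃⟩
    exact ⟨⟨fun m hm => h₁ m (.inl hm), h₂⟩, h₁ m (.inr rfl), fun l hl => h₃ l hl m (by simp)⟩
  · rintro ⟨⟨h₁, h₂⟩, h₃, h₄⟩
    refine ⟨?_, h₂, List.isChain_singleton _, fun l hl m' hm' => ?_⟩
    · rintro m' (hm' | rfl)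
      · exact h₁ m' hm'
      · exact h₃
    · obtain rfl : m = m' := by simpa using hm'
      exact h₄ l hl

theorem walkCost_concat : G.walkCost (W ++ [m]) = G.walkCost W + G.moveCost m := by
  simp [walkCost]

theorem Joins.concat (h : Joins s m.src W) : Joins s m.dst (W ++ [m]) := by
  right
  rcases h with ⟨rfl, h⟩ | ⟨h, -⟩
  · simp [h]
  · refine ⟨?_, by simp⟩
    cases W <;> simp_all

theorem Joins.of_concat (h : Joins s v (W ++ [m])) (hW : G.IsValidWalk (W ++ [m])) :
    m.dst = v ∧ Joins s m.src W := by
  rcases h with ⟨h, -⟩ | ⟨h₁, h₂⟩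
  · simp at h
  refine ⟨by simpa using h₂, ?_⟩
  rcases W.eq_nil_or_concat with rfl | ⟨W', l, rfl⟩
  · exact .inl ⟨rfl, by simpa using h₁.symm⟩
  · have := ((isValidWalk_concat.1 hW).2.2 l (by simp)).1
    refine .inr ⟨?_, by simp [this]⟩
    cases W' <;> simp_all

theorem Joins.mem_visited (h : Joins s v W) : v ∈ visited s W := by
  rcases h with ⟨rfl, rfl⟩ | ⟨-, h⟩
  · simp [visited]
  · obtain ⟨l, hl, rfl⟩ := Option.map_eq_some_iff.1 h
    simp only [visited, Finset.mem_insert, List.mem_toFinset, List.mem_append, List.mem_map]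
    exact .inr (.inr ⟨l, List.mem_of_getLast? hl, rfl⟩)

theorem visited_concat (h : Joins s m.src W) :
    visited s (W ++ [m]) = insert m.dst (visited s W) := by
  have := h.mem_visited
  ext w
  simp only [visited, Finset.mem_insert, List.mem_toFinset, List.mem_append, List.map_append,
    List.map_cons, List.map_nil, List.mem_singleton] at this ⊢
  constructor
  · rintro (h | (h | rfl) | h | h) <;> tauto
  · tauto

/-- A walk of cost `c` visits at most `c + 1` vertices, since each move to another vertex has a
positive cost. -/
theorem card_visited_le (hW : G.IsValidWalk W) (h : Joins s v W) :
    ((visited s W).card : ℕ∞) ≤ G.walkCost W + 1 := by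
  induction W using List.reverseRecOn generalizing v with
  | nil => simp [visited, walkCost]
  | append_singleton W m ih =>
    obtain ⟨rfl, hj⟩ := h.of_concat hW
    have ih := ih (isValidWalk_concat.1 hW).1 hj
    rw [visited_concat hj, walkCost_concat]
    by_cases hm : m.src = m.dst
    · rw [Finset.insert_eq_of_mem (hm ▸ hj.mem_visited)]
      exact ih.trans (by gcongr; exact le_self_add)
    · have h1 : 1 ≤ G.moveCost m := Order.one_le_iff_pos.2 (G.cost_pos _ _ _ _ hm)
      calc ((insert m.dst (visited s W)).card : ℕ∞) ≤ ((visited s W).card + 1 : ℕ) := by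
            exact_mod_cast Finset.card_insert_le _ _
        _ ≤ (G.walkCost W + 1) + G.moveCost m := by push_cast; gcongr
        _ = G.walkCost W + G.moveCost m + 1 := by ring

/-- `G.Reach h s q v t c`: by a walk without gaps in time, one can get from `s` at time `0` to `v` at
time `t` at cost `c` in such a way that the ones among the binary digits of `q` are exactly the
labels `h w` of the vertices `w` that are visited. -/
inductive Reach (G : TemporalCostGraph n T) (h : Fin n → ℕ) (s : Fin n) :
    ℕ → Fin n → ℕ → ℕ → Prop
  | start : Reach G h s (2 ^ h s) s 0 0
  | move {q c c' : ℕ} {u : Fin n} {a b : Fin T} (v : Fin n) : Reach G h s q u a c →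
      G.cost u v a b = c' → Reach G h s (q ||| 2 ^ h v) v b (c + c')

variable {h : Fin n → ℕ} {q t c : ℕ}

theorem lt_of_cost_eq_natCast {a b : Fin T} (hc : G.cost u v a b = (c : ℕ∞)) : a < b := by
  by_contra hab
  rw [G.cost_eq_top _ _ _ _ (not_lt.1 hab)] at hc
  exact ENat.top_ne_natCast _ hc

theorem Reach.exists_walk (hr : G.Reach h s q u t c) : ∃ W, G.IsValidWalk W ∧ Joins s u W ∧
    G.walkCost W = c ∧ (∀ m ∈ W.getLast?, m.arr.val ≤ t) ∧
    ∀ j, q.testBit j ↔ ∃ w ∈ visited s W, h w = j := by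
  induction hr with
  | start => exact ⟨[], by simp [IsValidWalk], .inl ⟨rfl, rfl⟩, by simp [walkCost], by simp,
      by simp [visited, Nat.testBit_two_pow]⟩
  | @move q c c' u a b v _ hc ih =>
    obtain ⟨W, hW, hj, hcost, hlast, hbit⟩ := ih
    have hj' : Joins s (Move.mk u v a b).src W := hj
    refine ⟨W ++ [⟨u, v, a, b⟩], isValidWalk_concat.2 ⟨hW, ⟨lt_of_cost_eq_natCast hc, ?_⟩, ?_⟩,
      hj'.concat, ?_, ?_, ?_⟩
    · simp [moveCost, hc]
    · intro l hl
      refine ⟨?_, hlast l hl⟩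
      rcases hj with ⟨rfl, -⟩ | ⟨-, hj⟩
      · simp at hl
      · simpa [Option.mem_def.1 hl] using hj
    · simp [walkCost_concat, hcost, moveCost, hc]
    · simp
    · intro j
      rw [visited_concat hj']
      simp [Nat.testBit_or, Nat.testBit_two_pow, hbit, or_comm]

theorem Reach.testBit_self (hr : G.Reach h s q u t c) : q.testBit (h u) := by
  cases hr <;> simp [Nat.testBit_or]

theorem Reach.lt_two_pow {K : ℕ} (hK : ∀ w, h w < K) (hr : G.Reach h s q u t c) : q < 2 ^ K := by
  induction hr with
  | start => exact Nat.pow_lt_pow_right (by omega) (hK s)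
  | move v _ _ ih => exact Nat.or_lt_two_pow ih (Nat.pow_lt_pow_right (by omega) (hK v))

/-- Waiting until the time `t'`. -/
theorem Reach.wait {t' : Fin T} (hr : G.Reach h s q u t c) (ht : t ≤ t') :
    G.Reach h s q u t' c := by
  rcases ht.eq_or_lt with rfl | ht
  · exact hr
  · have hr' : G.Reach h s q u (⟨t, ht.trans t'.2⟩ : Fin T) c := hr
    have := hr'.move (b := t') (c' := 0) u (by simpa using G.cost_self u ⟨t, ht.trans t'.2⟩ t' ht)
    rwa [Nat.or_two_pow_eq_self hr.testBit_self] at this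

/-- Each walk can be made a walk without gaps, since waiting is free. -/
theorem exists_reach (h : Fin n → ℕ) (hW : G.IsValidWalk W) (hj : Joins s v W)
    (hc : G.walkCost W = c) : ∃ q t, t ≤ T ∧ G.Reach h s q v t c ∧
      (∀ m ∈ W.getLast?, m.arr.val = t) ∧ (W = [] → t = 0) ∧
      ∀ j, q.testBit j ↔ ∃ w ∈ visited s W, h w = j := by
  induction W using List.reverseRecOn generalizing v c with
  | nil =>
    obtain rfl : s = v := by simpa [Joins] using hj
    obtain rfl : c = 0 := by simpa [walkCost, eq_comm] using hc
    exact ⟨_, 0, by omega, .start, by simp, by simp, by simp [visited, Nat.testBit_two_pow]⟩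
  | append_singleton W m ih =>
    obtain ⟨rfl, hj'⟩ := hj.of_concat hW
    obtain ⟨hW', ⟨-, hm⟩, hlast⟩ := isValidWalk_concat.1 hW
    rw [walkCost_concat] at hc
    obtain ⟨c₁, hc₁⟩ := ENat.ne_top_iff_exists.1
      (show G.walkCost W ≠ ⊤ by intro h; simp [h] at hc)
    obtain ⟨c₂, hc₂⟩ := ENat.ne_top_iff_exists.1 hm.ne
    obtain rfl : c₁ + c₂ = c := by rw [← hc₁, ← hc₂] at hc; exact_mod_cast hc
    obtain ⟨q, t, -, hr, ht, ht0, hbit⟩ := ih hW' hj' hc₁.symm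
    have hle : t ≤ m.dep := by
      rcases W.eq_nil_or_concat with rfl | ⟨W', l, rfl⟩
      · simp [ht0 rfl]
      · rw [← ht l (by simp)]
        exact (hlast l (by simp)).2
    refine ⟨_, m.arr, m.arr.2.le, (hr.wait hle).move (b := m.arr) m.dst hc₂.symm, by simp, by simp,
      fun j => ?_⟩
    rw [visited_concat hj']
    simp [Nat.testBit_or, Nat.testBit_two_pow, hbit, or_comm]

end TemporalCostGraph

namespace RAM

/-- The number of labels in the set that `q` encodes. -/
theorem Op.count_eq_card (K q : ℕ) :
    Op.count.fn K q = ((Finset.range K).filter fun j => q.testBit j).card := by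
  rw [Finset.card_filter]
  refine Finset.sum_congr rfl fun j _ => ?_
  rw [Nat.testBit_eq_decide_div_mod_eq]
  have := Nat.mod_two_eq_zero_or_one (q / 2 ^ j)
  split_ifs with hq <;> simp_all

end RAM

/-- Setting the binary digit `j` of `q` by arithmetic. -/
theorem Nat.add_one_sub_bit_mul_two_pow (q j : ℕ) :
    q + (1 - q / 2 ^ j % 2) * 2 ^ j = q ||| 2 ^ j := by
  rcases Nat.mod_two_eq_zero_or_one (q / 2 ^ j) with hq | hq
  · simp only [hq, Nat.sub_zero, one_mul]
    induction j generalizing q with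
    | zero =>
      have h₁ := Nat.or_div_two (a := q) (b := 2 ^ 0)
      have h₂ : (q ||| 1) % 2 = 1 := by simp
      simp only [pow_zero, Nat.div_one, Nat.reduceDiv, Nat.or_zero] at h₁ hq ⊢
      omega
    | succ j ih =>
      have h₁ := Nat.or_div_two (a := q) (b := 2 ^ (j + 1))
      have h₂ := Nat.or_mod_two_eq_one (a := q) (b := 2 ^ (j + 1))
      rw [pow_succ', ← Nat.div_div_eq_div_mul] at hq
      have ih := ih _ hq
      rw [pow_succ', Nat.mul_div_cancel_left _ two_pos, ← ih] at h₁
      rw [pow_succ'] at h₂ ⊢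
      omega
  · rw [Nat.or_two_pow_eq_self (by simp [Nat.testBit_eq_decide_div_mod_eq, hq])]
    simp [hq]

namespace CCTOInstance

open TemporalCostGraph

/-- The labels `h` reveal that the answer is yes: some state with at least `target` labels is
reachable within the budget. -/
def Reveals (x : CCTOInstance) (K : ℕ) (h : Fin x.n → ℕ) : Prop :=
  ∃ q t c, t ≤ x.T ∧ x.G.Reach h x.source q x.sink t c ∧ c ≤ x.budget ∧
    x.target ≤ RAM.Op.count.fn K q

theorem Reveals.isYes {x : CCTOInstance} {K : ℕ} {h : Fin x.n → ℕ} (hx : x.Reveals K h) :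
    x.IsYes := by
  obtain ⟨q, t, c, -, hr, hc, hk⟩ := hx
  obtain ⟨W, hW, hj, hcost, -, hbit⟩ := hr.exists_walk
  refine ⟨W, hW, hj, hk.trans ?_, by rw [hcost]; exact_mod_cast hc⟩
  rw [RAM.Op.count_eq_card]
  refine (Finset.card_le_card fun j hj => ?_).trans (Finset.card_image_le (f := h))
  simpa using (hbit j).1 (Finset.mem_filter.1 hj).2

/-- If labels separate `target` of the visited vertices, then they reveal that the answer is yes. -/
theorem reveals_of_injOn {x : CCTOInstance} {K : ℕ} {h : Fin x.n → ℕ} {W : List (Move x.n x.T)}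
    (hW : x.G.IsValidWalk W) (hj : Joins x.source x.sink W) (hc : x.G.walkCost W ≤ x.budget)
    {S : Finset (Fin x.n)} (hS : S ⊆ visited x.source W) (hcard : S.card = x.target)
    (hh : Set.InjOn h S) (hK : ∀ v, h v < K) : x.Reveals K h := by
  obtain ⟨c, hc'⟩ := ENat.ne_top_iff_exists.1 (ne_top_of_le_ne_top (ENat.natCast_ne_top _) hc)
  obtain ⟨q, t, ht, hr, -, -, hbit⟩ := exists_reach h hW hj hc'.symm
  refine ⟨q, t, c, ht, hr, by rw [← hc'] at hc; exact_mod_cast hc, ?_⟩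
  rw [← hcard, ← Finset.card_image_of_injOn hh, RAM.Op.count_eq_card]
  refine Finset.card_le_card fun j hj => ?_
  obtain ⟨w, hw, rfl⟩ := Finset.mem_image.1 hj
  simp only [Finset.mem_filter, Finset.mem_range]
  exact ⟨hK w, (hbit _).2 ⟨w, hS hw, rfl⟩⟩

end CCTOInstance

/-! ### A small family of hash functions -/

/-- A factor `a` that merges `x` and `y` is determined by the positive multiple of `K` by which
`a * x % p` exceeds `a * y % p`. -/
theorem Nat.card_hash_collisions_le {p K x y : ℕ} (hp : p.Prime) (hx : x < p) (hy : y < p)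
    (hxy : x ≠ y) : ((Finset.Ioo 0 p).filter fun a => a * y % p < a * x % p ∧
      a * x % p % K = a * y % p % K).card ≤ (p - 1) / K := by
  rw [← Nat.Ioc_filter_dvd_card_eq_div]
  refine Finset.card_le_card_of_injOn (fun a => a * x % p - a * y % p) ?_ ?_
  · intro a ha
    simp only [Finset.coe_filter, Finset.mem_Ioo, Set.mem_ofPred_eq] at ha
    have := Nat.mod_lt (a * x) hp.pos
    simp only [Finset.coe_filter, Finset.mem_Ioc, Set.mem_ofPred_eq]
    exact ⟨⟨by omega, by omega⟩, (Nat.modEq_iff_dvd' ha.2.1.le).1 ha.2.2.symm⟩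
  · intro a ha b hb hab
    simp only [Finset.coe_filter, Finset.mem_Ioo, Set.mem_ofPred_eq] at ha hb hab
    have : Fact p.Prime := ⟨hp⟩
    have h : ∀ a, a * y % p < a * x % p →
        (((a * x % p - a * y % p : ℕ) : ZMod p)) = a * (x - y) := by
      intro a ha
      rw [Nat.cast_sub ha.le]
      simp [mul_sub]
    have hne : (x : ZMod p) - y ≠ 0 := by
      rw [sub_ne_zero]
      intro h
      rw [ZMod.natCast_eq_natCast_iff'] at h
      rw [Nat.mod_eq_of_lt hx, Nat.mod_eq_of_lt hy] at h
      exact hxy h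
    have h' := congrArg (Nat.cast : ℕ → ZMod p) hab
    rw [h a ha.2.1, h b hb.2.1] at h'
    have h'' := mul_right_cancel₀ hne h'
    rw [ZMod.natCast_eq_natCast_iff'] at h''
    rwa [Nat.mod_eq_of_lt ha.1.2, Nat.mod_eq_of_lt hb.1.2] at h''

/-- Some of the maps `v ↦ (a * v % p) % K` with `p` and `a` linear in `n` separates the elements of a
given set of `k` numbers below `n` if `k² - k < K`: for a prime `p > n`, each pair is merged by at most a
fraction of about `2 / K` of the factors `a`. -/
theorem Nat.exists_injOn_hash {n K : ℕ} (hn : n ≠ 0) (S : Finset (Fin n))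
    (hK : S.card * S.card - S.card < K) : ∃ p < 2 * n, ∃ a < 2 * n,
      Set.InjOn (fun v : Fin n => a * v.val % (p + 1) % K) S := by
  obtain ⟨p, hp, hnp, hpn⟩ := Nat.exists_prime_lt_and_le_two_mul n hn
  suffices h : ∃ a ∈ Finset.Ioo 0 p, ∀ e ∈ S.offDiag, ¬ (a * e.2.val % p < a * e.1.val % p ∧
      a * e.1.val % p % K = a * e.2.val % p % K) by
    obtain ⟨a, ha, h⟩ := h
    have ha := Finset.mem_Ioo.1 ha
    refine ⟨p - 1, by omega, a, by omega, fun v hv w hw hvw => ?_⟩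
    rw [Nat.sub_add_cancel hp.one_le] at hvw
    by_contra hne
    have h₁ := h (v, w) (Finset.mem_offDiag.2 ⟨hv, hw, hne⟩)
    have h₂ := h (w, v) (Finset.mem_offDiag.2 ⟨hw, hv, Ne.symm hne⟩)
    have heq : a * v.val % p = a * w.val % p :=
      le_antisymm (not_lt.1 fun hlt => h₁ ⟨hlt, hvw⟩) (not_lt.1 fun hlt => h₂ ⟨hlt, hvw.symm⟩)
    have hcop : Nat.Coprime p a :=
      Nat.coprime_of_lt_prime ha.1.ne' ha.2 hp
    have := Nat.ModEq.cancel_left_of_coprime hcop heq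
    rw [Nat.ModEq, Nat.mod_eq_of_lt (by omega), Nat.mod_eq_of_lt (by omega)] at this
    exact hne (Fin.ext this)
  -- Otherwise the `p - 1` factors would all be among the at most `(k² - k) * ((p - 1) / K)` bad ones.
  by_contra! hcon
  have hsub : Finset.Ioo 0 p ⊆ S.offDiag.biUnion fun e => (Finset.Ioo 0 p).filter fun a =>
      a * e.2.val % p < a * e.1.val % p ∧ a * e.1.val % p % K = a * e.2.val % p % K := by
    intro a ha
    obtain ⟨e, he, h⟩ := hcon a ha
    exact Finset.mem_biUnion.2 ⟨e, he, Finset.mem_filter.2 ⟨ha, h⟩⟩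
  have hle := (Finset.card_le_card hsub).trans (Finset.card_biUnion_le_card_mul _ _ ((p - 1) / K)
    fun e he => Nat.card_hash_collisions_le hp (e.1.2.trans hnp) (e.2.2.trans hnp)
      fun h => (Finset.mem_offDiag.1 he).2.2 (Fin.ext h))
  rw [Nat.card_Ioo, Finset.offDiag_card] at hle
  have hdiv := Nat.div_mul_le_self (p - 1) K
  have hp1 : 0 < p - 1 := by have := hp.two_le; omega
  rcases Nat.eq_zero_or_pos ((p - 1) / K) with h0 | h0
  · rw [h0] at hle; omega
  · have := Nat.mul_lt_mul_of_pos_right hK h0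
    rw [mul_comm K] at this
    omega

/-- If the answer is yes, then one of the hash functions reveals it. -/
theorem CCTOInstance.IsYes.exists_reveals {x : CCTOInstance} (hx : x.IsYes) :
    ∃ p < 2 * x.n, ∃ a < 2 * x.n, x.Reveals ((x.budget + 1) * (x.budget + 1))
      fun v => a * v.val % (p + 1) % ((x.budget + 1) * (x.budget + 1)) := by
  obtain ⟨W, hW, hj, hk, hc⟩ := hx
  obtain ⟨S, hS, hcard⟩ := Finset.exists_subset_card_eq hk
  have hle : x.target ≤ x.budget + 1 := by
    have := (TemporalCostGraph.card_visited_le hW hj).trans (add_le_add_left hc 1)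
    exact hk.trans (by exact_mod_cast this)
  have hn : x.n ≠ 0 := by
    have := x.source.2
    omega
  -- With `k ≤ f + 1` labels to be kept apart, `(f + 1)²` values of the hash function suffice.
  have hK : S.card * S.card - S.card < (x.budget + 1) * (x.budget + 1) := by
    rw [hcard]
    have := Nat.mul_le_mul hle hle
    rcases Nat.eq_zero_or_pos x.target with h0 | h0
    · simp [h0]
    · have := Nat.le_mul_self x.target
      omega
  obtain ⟨p, hp, a, ha, hinj⟩ := Nat.exists_injOn_hash hn S hK
  exact ⟨p, hp, a, ha, CCTOInstance.reveals_of_injOn hW hj hc hS hcard hinj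
    fun v => Nat.mod_lt _ (by positivity)⟩

/-! ### The layout of the input -/

theorem List.length_flatMap_of_length_eq {α β : Type*} (l : List α) {f : α → List β} {L : ℕ}
    (hf : ∀ a, (f a).length = L) : (l.flatMap f).length = l.length * L := by
  induction l with
  | nil => simp
  | cons a l ih => simp [ih, hf, add_mul, add_comm]

theorem List.getD_flatMap {α β : Type*} (l : List α) {f : α → List β} {L : ℕ}
    (hf : ∀ a, (f a).length = L) {i j : ℕ} (hi : i < l.length) (hj : j < L) (d : β) :
    (l.flatMap f).getD (i * L + j) d = (f l[i]).getD j d := by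
  induction l generalizing i with
  | nil => simp at hi
  | cons a l ih =>
    rw [List.flatMap_cons]
    cases i with
    | zero => rw [List.getD_append _ _ _ _ (by rw [hf]; omega)]; simp
    | succ i =>
      rw [List.getD_append_right _ _ _ _ (by rw [hf, add_mul]; omega), hf,
        show (i + 1) * L + j - L = i * L + j by rw [add_mul]; omega, ih (by simpa using hi)]
      simp

theorem Nat.mul_add_lt_mul {T N i b : ℕ} (hi : i < N) (hb : b < T) : T * i + b < T * N := by
  have := Nat.mul_le_mul_left T (Nat.succ_le_of_lt hi)
  rw [Nat.mul_succ] at this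
  omega

namespace CCTOInstance

variable (x : CCTOInstance)

theorem length_graphCode : x.graphCode.length = x.n * x.n := by
  rw [graphCode, List.length_flatMap_of_length_eq _ (L := x.n) (by simp), List.length_finRange]

theorem length_costTable : x.costTable.length = x.n * (x.n * (x.T * x.T)) := by
  have h₁ : ∀ u v : Fin x.n, ((List.finRange x.T).flatMap fun t₁ => (List.finRange x.T).map fun t₂ =>
      costCode (x.G.cost u v t₁ t₂)).length = x.T * x.T := fun u v => by
    rw [List.length_flatMap_of_length_eq _ (L := x.T) (by simp), List.length_finRange]
  rw [costTable, List.length_flatMap_of_length_eq _ (L := x.n * (x.T * x.T)), List.length_finRange]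
  intro u
  rw [List.length_flatMap_of_length_eq _ (h₁ u), List.length_finRange]

theorem getD_costTable (u v : Fin x.n) (a b : Fin x.T) :
    x.costTable.getD (x.T * (x.T * (x.n * u + v) + a) + b) 0 = costCode (x.G.cost u v a b) := by
  have h₁ : ∀ u v : Fin x.n, ((List.finRange x.T).flatMap fun t₁ => (List.finRange x.T).map fun t₂ =>
      costCode (x.G.cost u v t₁ t₂)).length = x.T * x.T := fun u v => by
    rw [List.length_flatMap_of_length_eq _ (L := x.T) (by simp), List.length_finRange]
  have h₂ : ∀ u : Fin x.n, ((List.finRange x.n).flatMap fun v => (List.finRange x.T).flatMap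
      fun t₁ => (List.finRange x.T).map fun t₂ => costCode (x.G.cost u v t₁ t₂)).length =
      x.n * (x.T * x.T) := fun u => by
    rw [List.length_flatMap_of_length_eq _ (h₁ u), List.length_finRange]
  have hab : a.val * x.T + b < x.T * x.T := by
    have := Nat.mul_le_mul_right x.T (Nat.succ_le_of_lt a.2)
    have := b.2
    rw [Nat.succ_mul] at *
    omega
  have hvab : v.val * (x.T * x.T) + (a.val * x.T + b) < x.n * (x.T * x.T) := by
    have := Nat.mul_le_mul_right (x.T * x.T) (Nat.succ_le_of_lt v.2)
    rw [Nat.succ_mul] at *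
    omega
  have heq : x.T * (x.T * (x.n * u + v) + a) + b =
      u.val * (x.n * (x.T * x.T)) + (v.val * (x.T * x.T) + (a.val * x.T + b)) := by ring
  rw [heq, costTable, List.getD_flatMap _ h₂ (by simp) hvab, List.getD_flatMap _ (h₁ _) (by simp) hab,
    List.getD_flatMap _ (L := x.T) (by simp) (by simp) b.2]
  simp

theorem length_encode :
    x.encode.length = 6 + x.n * x.n + x.n * (x.n * (x.T * x.T)) := by
  simp [encode, length_graphCode, length_costTable]; ring

theorem getD_encode_cost (u v : Fin x.n) (a b : Fin x.T) :
    x.encode.getD (6 + x.n * x.n + (x.T * (x.T * (x.n * u + v) + a) + b)) 0 =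
      costCode (x.G.cost u v a b) := by
  rw [encode, List.getD_append_right _ _ _ _ (by simp [length_graphCode]; omega),
    ← getD_costTable]
  congr 1
  simp [length_graphCode]; omega

theorem cost_index_lt (u v : Fin x.n) (a b : Fin x.T) :
    6 + x.n * x.n + (x.T * (x.T * (x.n * u + v) + a) + b) < x.encode.length := by
  have h₁ := Nat.mul_add_lt_mul (Nat.mul_add_lt_mul (Nat.mul_add_lt_mul u.2 v.2) a.2) b.2
  have h₂ : x.T * (x.T * (x.n * x.n)) = x.n * (x.n * (x.T * x.T)) := by ring
  rw [length_encode]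
  omega

end CCTOInstance

/-! ### The program

The registers below `14` hold the parameters, `14` and `15` the hash function, `16` to `20` are loop
counters, and higher registers are scratch space. Behind the input, the memory holds the answer so
far, the labels of the `n` vertices, and the table. Its entries are indexed by label sets, vertices
and `T + 1` times, so that the start has an entry even for `T = 0`. An entry is `0` for `∞` and `c + 1`
for the cost `c`, as in the input. -/

namespace CCTOInstance

open RAM RAM.Prog TemporalCostGraph

/-- The number of labels. -/
def numLabels (x : CCTOInstance) : ℕ := (x.budget + 1) * (x.budget + 1)

/-- The values of the registers that are set once and for all. -/
noncomputable def param (x : CCTOInstance) : ℕ → ℕ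
  | 0 => x.encode.length
  | 1 => x.n
  | 2 => x.T
  | 3 => x.source
  | 4 => x.sink
  | 5 => x.target
  | 6 => x.budget
  | 7 => x.numLabels
  | 8 => 2 ^ x.numLabels
  | 9 => x.T + 1
  | 10 => x.encode.length + (1 + x.n)
  | 11 => 6 + x.n * x.n
  | 12 => x.n + x.n
  | 13 => (x.T + 1) * (x.n * 2 ^ x.numLabels)
  | _ => 0

/-- The terms that compute the parameters, each from those before it. -/
def paramTerm : ℕ → Term
  | 1 => .load (.const 0)
  | 2 => .load (.const 1)
  | 3 => .load (.const 2)
  | 4 => .load (.const 3)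
  | 5 => .load (.const 4)
  | 6 => .load (.const 5)
  | 7 => .op .mul (.add (.reg 6) (.const 1)) (.add (.reg 6) (.const 1))
  | 8 => .op .pow (.reg 7) (.const 0)
  | 9 => .add (.reg 2) (.const 1)
  | 10 => .add (.reg 0) (.add (.const 1) (.reg 1))
  | 11 => .add (.const 6) (.op .mul (.reg 1) (.reg 1))
  | 12 => .add (.reg 1) (.reg 1)
  | 13 => .op .mul (.reg 9) (.op .mul (.reg 1) (.reg 8))
  | _ => .const 0

/-- The program that sets the parameters up to the given one. -/
def setupProg : ℕ → Prog
  | 0 => .skip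
  | i + 1 => .seq (setupProg i) ((paramTerm (i + 1)).prog (i + 1))

/-- The address of the table entry for the label set `q`, the vertex `v` and the time `t`. -/
def cellTerm (q v t : Term) : Term :=
  .add (.reg 10) (.add (.op .mul (.reg 9) (.add (.op .mul (.reg 1) q) v)) t)

/-- The label of a vertex. -/
def labelTerm (v : Term) : Term := .load (.add (.add (.reg 0) (.const 1)) v)

/-- The label set `q` together with the label `j`. -/
def insertTerm (q j : Term) : Term :=
  .add q (.op .mul (.sub (.const 1) (.op .mod (.op .shift j q) (.const 2))) (.op .pow j (.const 0)))

/-- The code of the cost of the current move, from the vertex in register `18` at the time in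
register `16` to the vertex in register `19` at the time in register `20`. -/
def costTerm : Term :=
  .load (.add (.reg 11) (.add (.op .mul (.reg 2) (.add (.op .mul (.reg 2)
    (.add (.op .mul (.reg 1) (.reg 18)) (.reg 19))) (.reg 16))) (.reg 20)))

/-- The new value of a table entry `e` in view of a move with cost code `w` from a state with table
entry `d`. -/
def relaxTerm (w d e : Term) : Term :=
  .ite w (.ite d (.ite e (.ite (.sub e (.sub (.add d w) (.const 1)))
    (.sub (.add d w) (.const 1)) e) (.sub (.add d w) (.const 1))) e) e

/-- Write the labels of the vertices behind the input and one cell for the answer. -/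
def labelProg : Prog :=
  forLoop 16 1 (Term.storeProg 17 (.add (.add (.reg 0) (.const 1)) (.reg 16))
    (.op .mod (.op .mod (.op .mul (.reg 15) (.reg 16)) (.add (.reg 14) (.const 1))) (.reg 7)))

/-- Fill the table with zeros. -/
def clearProg : Prog :=
  forLoop 16 13 (Term.storeProg 17 (.add (.reg 10) (.reg 16)) (.const 0))

/-- Enter the state in which all walks start. -/
def startProg : Prog :=
  Term.storeProg 16 (cellTerm (.op .pow (labelTerm (.reg 3)) (.const 0)) (.reg 3) (.const 0))
    (.const 1)

/-- The table entry that a move leads to. -/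
def nextTerm : Term :=
  cellTerm (insertTerm (.reg 17) (labelTerm (.reg 19))) (.reg 19) (.reg 20)

/-- Take one move from one state into account. -/
def relaxBody : Prog :=
  Term.storeProg 21 nextTerm
    (relaxTerm costTerm (.load (cellTerm (.reg 17) (.reg 18) (.reg 16))) (.load nextTerm))

/-- Take all moves from all states into account, in the order of departure. -/
def relaxProg : Prog :=
  forLoop 16 2 (forLoop 17 8 (forLoop 18 1 (forLoop 19 1 (forLoop 20 2 relaxBody))))

/-- Record the answer yes if the table has a suitable entry for the sink. -/
def answerProg : Prog :=
  forLoop 16 8 (forLoop 17 9 (Term.storeProg 18 (.reg 0)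
    (.ite (.load (cellTerm (.reg 16) (.reg 4) (.reg 17)))
      (.ite (.sub (.add (.reg 6) (.const 2)) (.load (cellTerm (.reg 16) (.reg 4) (.reg 17))))
        (.ite (.sub (.add (.op .count (.reg 7) (.reg 16)) (.const 1)) (.reg 5)) (.const 1)
          (.load (.reg 0))) (.load (.reg 0))) (.load (.reg 0)))))

/-- One round, with the hash function given by the registers `14` and `15`. -/
def roundProg : Prog :=
  .seq labelProg (.seq clearProg (.seq startProg (.seq relaxProg answerProg)))

/-- The program for Changing Cost Temporal Orienteering. -/
def mainProg : Prog :=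
  .seq (setupProg 13) (.seq (forLoop 14 12 (forLoop 15 12 roundProg)) (.assign 0 (.load (.reg 0))))

variable {x : CCTOInstance} {B : ℕ} {σ : State} {h : Fin x.n → ℕ} {w : ℕ} {m : ℕ → ℕ}

/-- No loop of the program is run through more than `B` times. -/
structure Fits (x : CCTOInstance) (B : ℕ) : Prop where
  n : x.n + x.n ≤ B
  T : x.T + 1 ≤ B
  budget : x.budget + 1 ≤ B
  labels : x.numLabels ≤ B
  pow : 2 ^ x.numLabels ≤ B
  table : (x.T + 1) * (x.n * 2 ^ x.numLabels) ≤ B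
  product : (x.n + x.n) * x.n ≤ B

/-- The registers hold the parameters. -/
def Ready (x : CCTOInstance) (σ : State) : Prop := ∀ i < 14, σ.reg i = x.param i

theorem setupProg_ensures (hB : x.Fits B) : (setupProg 13).Ensures B (init x.encode) fun σ =>
    σ.mem = (init x.encode).mem ∧ x.Ready σ := by
  have key : ∀ i ≤ 13, (setupProg i).Ensures B (init x.encode) fun σ =>
      σ.mem = (init x.encode).mem ∧ ∀ j < i + 1, σ.reg j = x.param j := by
    intro i
    induction i with
    | zero =>
      intro _
      refine .skip ⟨rfl, fun j hj => ?_⟩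
      obtain rfl : j = 0 := by omega
      rfl
    | succ i ih =>
      intro hi
      refine .seq ((ih (by omega)).mono ?_)
      rintro σ ⟨hm, hr⟩
      have hmem : ∀ j, σ.mem j = x.encode.getD j 0 := fun j => by rw [hm]; rfl
      obtain ⟨h₁, h₂, h₃⟩ : (paramTerm (i + 1)).Below (i + 1) ∧
          (paramTerm (i + 1)).Bounded B σ ∧ (paramTerm (i + 1)).eval σ = x.param (i + 1) := by
        obtain ⟨hbn, hbT, hbf, hbK, -⟩ := hB
        have hi' : i < 13 := hi
        clear ih hi
        interval_cases i
        all_goals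
          simp only [paramTerm, Term.Below, Term.Bounded, Term.eval, Op.fn, hmem]
        all_goals
          try rw [hr 0 (by norm_num)]
          try rw [hr 1 (by norm_num)]
          try rw [hr 2 (by norm_num)]
          try rw [hr 6 (by norm_num)]
          try rw [hr 7 (by norm_num)]
          try rw [hr 8 (by norm_num)]
          try rw [hr 9 (by norm_num)]
        all_goals
          simp [param, encode, numLabels] at hbK ⊢
        all_goals omega
      refine (Term.prog_ensures _ h₁ h₂).mono ?_
      rintro τ ⟨hm', hd, hr'⟩
      refine ⟨hm'.trans hm, fun j hj => ?_⟩
      rcases Nat.lt_succ_iff_lt_or_eq.1 hj with hj | rfl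
      · rw [hr' j hj, hr j hj]
      · rw [hd, h₃]
  exact key 13 le_rfl

end CCTOInstance

/-! ### Correctness of the dynamic program -/

namespace CCTOInstance

open RAM RAM.Prog TemporalCostGraph

variable {x : CCTOInstance} {B : ℕ} {σ : State} {h : Fin x.n → ℕ} {w : ℕ} {m m' : ℕ → ℕ}

/-- The memory holds the input, the answer `w` so far, and the labels `h`. -/
structure Holds (x : CCTOInstance) (h : Fin x.n → ℕ) (w : ℕ) (m : ℕ → ℕ) : Prop where
  input : ∀ i < x.encode.length, m i = x.encode.getD i 0
  answer : m x.encode.length = w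
  label : ∀ v, m (x.encode.length + 1 + v.val) = h v

theorem Holds.update (hm : x.Holds h w m) {i : ℕ} (hi : x.encode.length + (1 + x.n) ≤ i) (y : ℕ) :
    x.Holds h w (Function.update m i y) where
  input j hj := by rw [Function.update_of_ne (by omega), hm.input j hj]
  answer := by rw [Function.update_of_ne (by omega), hm.answer]
  label v := by rw [Function.update_of_ne (by omega), hm.label]

/-- The address of the table entry for the label set `q`, the vertex `v` and the time `t`. -/
noncomputable def cell (x : CCTOInstance) (q v t : ℕ) : ℕ :=
  x.encode.length + (1 + x.n) + ((x.T + 1) * (x.n * q + v) + t)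

theorem le_cell (q v t : ℕ) : x.encode.length + (1 + x.n) ≤ x.cell q v t := Nat.le_add_right _ _

theorem cell_inj {q q' t t' : ℕ} {v v' : Fin x.n} (ht : t ≤ x.T) (ht' : t' ≤ x.T)
    (heq : x.cell q v t = x.cell q' v' t') : q = q' ∧ v = v' ∧ t = t' := by
  have key : ∀ {n a b c d : ℕ}, b < n → d < n → n * a + b = n * c + d → a = c ∧ b = d := by
    intro n a b c d hb hd h
    have hn : 0 < n := by omega
    have h₁ := congrArg (· / n) h
    have h₂ := congrArg (· % n) h
    simp only [Nat.mul_add_div hn, Nat.div_eq_of_lt hb, Nat.div_eq_of_lt hd, add_zero,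
      Nat.mul_add_mod, Nat.mod_eq_of_lt hb, Nat.mod_eq_of_lt hd] at h₁ h₂
    exact ⟨h₁, h₂⟩
  obtain ⟨h₁, h₂⟩ := key (Nat.lt_succ_of_le ht) (Nat.lt_succ_of_le ht') (Nat.add_left_cancel heq)
  obtain ⟨h₃, h₄⟩ := key v.2 v'.2 h₁
  exact ⟨h₃, Fin.ext h₄, h₂⟩

/-- The table entry `e` grants the cost `c`: it is the code of a cost of at most `c`. -/
def Grants (e c : ℕ) : Prop := 0 < e ∧ e ≤ c + 1

/-- No table entry gets worse. -/
def Improves (m m' : ℕ → ℕ) : Prop := ∀ i c, Grants (m i) c → Grants (m' i) c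

/-- Each table entry is either zero or the code of the cost of a walk. -/
def Sound (x : CCTOInstance) (h : Fin x.n → ℕ) (m : ℕ → ℕ) : Prop :=
  ∀ q < 2 ^ x.numLabels, ∀ (v : Fin x.n), ∀ t ≤ x.T, m (x.cell q v t) ≠ 0 →
    ∃ c, x.G.Reach h x.source q v t c ∧ m (x.cell q v t) = c + 1

/-- The table takes all walks to the vertex `v` into account that arrive at time `t`. -/
def CompleteAt (x : CCTOInstance) (h : Fin x.n → ℕ) (t : ℕ) (m : ℕ → ℕ) : Prop :=
  ∀ q v c, x.G.Reach h x.source q v t c → Grants (m (x.cell q v t)) c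

theorem CompleteAt.improves {t : ℕ} (hm : x.CompleteAt h t m) (hi : Improves m m') :
    x.CompleteAt h t m' := fun q v c hr => hi _ _ (hm q v c hr)

/-- The value of `relaxTerm`. -/
def relaxValue (w d e : ℕ) : ℕ :=
  if w ≠ 0 ∧ d ≠ 0 ∧ (e = 0 ∨ d + w - 1 < e) then d + w - 1 else e

theorem relaxTerm_eval (w d e : Term) :
    (relaxTerm w d e).eval σ = relaxValue (w.eval σ) (d.eval σ) (e.eval σ) := by
  simp only [relaxTerm, Term.eval, relaxValue]
  have hlt : e.eval σ - (d.eval σ + w.eval σ - 1) ≠ 0 ↔ d.eval σ + w.eval σ - 1 < e.eval σ := by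
    omega
  simp only [hlt]
  by_cases hw : w.eval σ = 0 <;> by_cases hd : d.eval σ = 0 <;> by_cases he : e.eval σ = 0 <;>
    simp [hw, hd, he]

theorem relaxValue_cases (w d e : ℕ) :
    relaxValue w d e = e ∨ w ≠ 0 ∧ d ≠ 0 ∧ relaxValue w d e = d + w - 1 := by
  unfold relaxValue
  split_ifs <;> omega

theorem Grants.relaxValue {w d e c : ℕ} (he : Grants e c) : Grants (relaxValue w d e) c := by
  unfold CCTOInstance.relaxValue Grants at *
  split_ifs <;> omega

theorem Grants.relaxValue_add {c d e c' : ℕ} (hd : Grants d c) :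
    Grants (CCTOInstance.relaxValue (c' + 1) d e) (c + c') := by
  unfold CCTOInstance.relaxValue Grants at *
  split_ifs <;> omega

theorem costCode_coe (c : ℕ) : costCode c = c + 1 := by simp [costCode]

theorem costCode_ne_zero {c : ℕ∞} (hc : costCode c ≠ 0) : ∃ c' : ℕ, c = c' ∧ costCode c = c' + 1 := by
  obtain ⟨c', rfl⟩ := ENat.ne_top_iff_exists.1 (show c ≠ ⊤ by rintro rfl; simp [costCode] at hc)
  exact ⟨c', rfl, costCode_coe c'⟩

/-- The effect of taking the move from `u` at time `a` to `v` at time `b` into account for the label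
set `q`. -/
theorem relaxBody_ensures (hB : x.Fits B) (hK : ∀ v, h v < x.numLabels) (hσ : x.Ready σ)
    {q : ℕ} {u v : Fin x.n} {a b : Fin x.T} (hq : q < 2 ^ x.numLabels)
    (h16 : σ.reg 16 = a) (h17 : σ.reg 17 = q) (h18 : σ.reg 18 = u) (h19 : σ.reg 19 = v)
    (h20 : σ.reg 20 = b) (hm : x.Holds h w σ.mem) :
    relaxBody.Ensures B σ fun τ => τ.mem = Function.update σ.mem (x.cell (q ||| 2 ^ h v) v b)
      (relaxValue (costCode (x.G.cost u v a b)) (σ.mem (x.cell q u a))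
        (σ.mem (x.cell (q ||| 2 ^ h v) v b))) := by
  have h0 : σ.reg 0 = x.encode.length := hσ 0 (by norm_num)
  have h1 : σ.reg 1 = x.n := hσ 1 (by norm_num)
  have h2 : σ.reg 2 = x.T := hσ 2 (by norm_num)
  have h9 : σ.reg 9 = x.T + 1 := hσ 9 (by norm_num)
  have h10 : σ.reg 10 = x.encode.length + (1 + x.n) := hσ 10 (by norm_num)
  have h11 : σ.reg 11 = 6 + x.n * x.n := hσ 11 (by norm_num)
  have hlab := hm.label v
  have hcost := (hm.input _ (x.cost_index_lt u v a b)).trans (x.getD_encode_cost u v a b)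
  have hnext : nextTerm.eval σ = x.cell (q ||| 2 ^ h v) v b := by
    simp only [nextTerm, cellTerm, insertTerm, labelTerm, Term.eval, Op.fn, h0, h1, h9, h10, h17,
      h19, h20, hlab, Nat.add_one_sub_bit_mul_two_pow, cell]
  have hfrom : (cellTerm (.reg 17) (.reg 18) (.reg 16)).eval σ = x.cell q u a := by
    simp only [cellTerm, Term.eval, Op.fn, h1, h9, h10, h16, h17, h18, cell]
  have hcostTerm : costTerm.eval σ = costCode (x.G.cost u v a b) := by
    simp only [costTerm, Term.eval, Op.fn, h1, h2, h11, h16, h18, h19, h20, hcost]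
  have hqB : q / 2 ^ h v ≤ B := (Nat.div_le_self _ _).trans (hq.le.trans hB.pow)
  have hvB : h v ≤ B := (hK v).le.trans hB.labels
  obtain ⟨hBn, hBT, -⟩ := hB
  have hnextB : nextTerm.Bounded B σ := by
    simp only [nextTerm, cellTerm, insertTerm, labelTerm, Term.eval, Op.fn, Term.Bounded, h0, h1,
      h9, h17, h19, hlab]
    have : 1 - q / 2 ^ h v % 2 ≤ B := by omega
    simp only [hqB, hvB, this, true_and, and_true]
    omega
  have hfromB : (cellTerm (.reg 17) (.reg 18) (.reg 16)).Bounded B σ := by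
    simp only [cellTerm, Term.eval, Term.Bounded, h1, h9, true_and, and_true]
    omega
  have hcostB : costTerm.Bounded B σ := by
    simp only [costTerm, Term.eval, Term.Bounded, h1, h2, true_and, and_true]
    omega
  refine (Term.storeProg_ensures ?_ ?_ hnextB ?_).mono fun τ hτ => ?_
  · simp [nextTerm, cellTerm, insertTerm, labelTerm, Term.Below]
  · simp [relaxTerm, costTerm, nextTerm, cellTerm, insertTerm, labelTerm, Term.Below]
  · simp only [relaxTerm, Term.Bounded, and_true]
    exact ⟨hcostB, ⟨hfromB, ⟨hnextB, ⟨⟨hnextB, hfromB, hcostB⟩, ⟨hfromB, hcostB⟩, hnextB⟩,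
      hfromB, hcostB⟩, hnextB⟩, hnextB⟩
  · rw [hτ, relaxTerm_eval, hnext]
    simp only [Term.eval, hnext, hfrom, hcostTerm]

theorem relaxBody_above : relaxBody.Above 21 := Term.storeProg_above _ _ _

/-- What holds throughout while the moves that depart at time `a` are taken into account. -/
def RelaxInv (x : CCTOInstance) (h : Fin x.n → ℕ) (w a : ℕ) (m : ℕ → ℕ) : Prop :=
  x.Holds h w m ∧ x.Sound h m ∧ x.CompleteAt h a m

/-- The move from `u` at time `a` to `v` at time `b` is taken into account for the label set `q`. -/
def Relaxed (x : CCTOInstance) (h : Fin x.n → ℕ) (a q u v b : ℕ) (m : ℕ → ℕ) : Prop :=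
  ∀ (u' v' : Fin x.n) (a' b' : Fin x.T) (c c' : ℕ), u'.val = u → v'.val = v → a'.val = a →
    b'.val = b → x.G.Reach h x.source q u' a c → x.G.cost u' v' a' b' = c' →
    Grants (m (x.cell (q ||| 2 ^ h v') v' b)) (c + c')

theorem Relaxed.improves {a q u v b : ℕ} (hm : x.Relaxed h a q u v b m) (hi : Improves m m') :
    x.Relaxed h a q u v b m' :=
  fun u' v' a' b' c c' h₁ h₂ h₃ h₄ h₅ h₆ => hi _ _ (hm u' v' a' b' c c' h₁ h₂ h₃ h₄ h₅ h₆)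

theorem Improves.refl (m : ℕ → ℕ) : Improves m m := fun _ _ h => h

theorem Improves.trans {m₁ m₂ m₃ : ℕ → ℕ} (h₁ : Improves m₁ m₂) (h₂ : Improves m₂ m₃) :
    Improves m₁ m₃ := fun i c h => h₂ i c (h₁ i c h)

theorem relaxBody_step (hB : x.Fits B) (hK : ∀ v, h v < x.numLabels) (hσ : x.Ready σ)
    {q : ℕ} {u v : Fin x.n} {a b : Fin x.T} (hq : q < 2 ^ x.numLabels)
    (h16 : σ.reg 16 = a) (h17 : σ.reg 17 = q) (h18 : σ.reg 18 = u) (h19 : σ.reg 19 = v)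
    (h20 : σ.reg 20 = b) (hm : x.RelaxInv h w a σ.mem) :
    relaxBody.Ensures B σ fun τ => x.RelaxInv h w a τ.mem ∧ Improves σ.mem τ.mem ∧
      x.Relaxed h a q u v b τ.mem := by
  obtain ⟨hm, hs, hc⟩ := hm
  refine (relaxBody_ensures hB hK hσ hq h16 h17 h18 h19 h20 hm).mono ?_
  rintro τ hτ
  have himp : Improves σ.mem τ.mem := by
    intro i c hi
    rw [hτ]
    rcases eq_or_ne i (x.cell (q ||| 2 ^ h v) v b) with rfl | hne
    · rw [Function.update_self]; exact hi.relaxValue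
    · rwa [Function.update_of_ne hne]
  refine ⟨⟨hτ ▸ hm.update (le_cell _ _ _) _, ?_, hc.improves himp⟩, himp, ?_⟩
  · intro q' hq' v' t ht hne
    by_cases heq : x.cell q' v' t = x.cell (q ||| 2 ^ h v) v b
    · obtain ⟨rfl, rfl, rfl⟩ := cell_inj ht b.2.le heq
      rw [hτ, Function.update_self] at hne ⊢
      rcases relaxValue_cases (costCode (x.G.cost u v' a b)) (σ.mem (x.cell q u a))
        (σ.mem (x.cell (q ||| 2 ^ h v') v' b)) with he | ⟨hw, hd, he⟩
      · rw [he] at hne ⊢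
        exact hs _ hq' v' _ ht hne
      · obtain ⟨c', hc', hcode⟩ := costCode_ne_zero hw
        obtain ⟨c, hr, hd'⟩ := hs q hq u a a.2.le hd
        exact ⟨_, hr.move v' hc', by rw [he, hcode, hd']; omega⟩
    · rw [hτ, Function.update_of_ne heq] at hne ⊢
      exact hs q' hq' v' t ht hne
  · intro u' v' a' b' c c' hu' hv' ha' hb' hr hcost
    obtain rfl := Fin.ext hu'
    obtain rfl := Fin.ext hv'
    obtain rfl := Fin.ext ha'
    obtain rfl := Fin.ext hb'
    rw [hτ, Function.update_self, hcost, costCode_coe]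
    exact (hc q _ c hr).relaxValue_add

/-- All moves that depart at time `a` are taken into account. -/
theorem relaxProg_step (hB : x.Fits B) (hK : ∀ v, h v < x.numLabels) (hσ : x.Ready σ)
    {a : Fin x.T} (h16 : σ.reg 16 = a) (hm : x.RelaxInv h w a σ.mem) :
    (forLoop 17 8 (forLoop 18 1 (forLoop 19 1 (forLoop 20 2 relaxBody)))).Ensures B σ fun τ =>
      x.RelaxInv h w a τ.mem ∧ Improves σ.mem τ.mem ∧ ∀ q < 2 ^ x.numLabels, ∀ u < x.n, ∀ v < x.n,
        ∀ b < x.T, x.Relaxed h a q u v b τ.mem := by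
  have hn : x.n ≤ B := (Nat.le_add_left _ _).trans hB.n
  have hT : x.T ≤ B := (Nat.le_succ _).trans hB.T
  have above₁ : (forLoop 20 2 relaxBody).Above 20 :=
    forLoop_above le_rfl (relaxBody_above.mono (by norm_num))
  have above₂ : (forLoop 19 1 (forLoop 20 2 relaxBody)).Above 19 :=
    forLoop_above le_rfl (above₁.mono (by norm_num))
  have above₃ : (forLoop 18 1 (forLoop 19 1 (forLoop 20 2 relaxBody))).Above 18 :=
    forLoop_above le_rfl (above₂.mono (by norm_num))
  refine Ensures.forEach (x.RelaxInv h w a) Improves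
    (fun q m => ∀ u < x.n, ∀ v < x.n, ∀ b < x.T, x.Relaxed h a q u v b m) .refl (fun _ _ _ => .trans)
    (fun q _ _ hi h u hu v hv b hb => (h u hu v hv b hb).improves hi) (by norm_num) above₃
    (hσ 8 (by norm_num)) hB.pow hm fun q hq σ₁ hσ₁ h17 hm₁ _ => ?_
  refine Ensures.forEach (x.RelaxInv h w a) Improves
    (fun u m => ∀ v < x.n, ∀ b < x.T, x.Relaxed h a q u v b m) .refl (fun _ _ _ => .trans)
    (fun u _ _ hi h v hv b hb => (h v hv b hb).improves hi) (by norm_num) above₂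
    ((hσ₁ 1 (by norm_num)).trans (hσ 1 (by norm_num))) hn hm₁ fun u hu σ₂ hσ₂ h18 hm₂ _ => ?_
  refine Ensures.forEach (x.RelaxInv h w a) Improves
    (fun v m => ∀ b < x.T, x.Relaxed h a q u v b m) .refl (fun _ _ _ => .trans)
    (fun v _ _ hi h b hb => (h b hb).improves hi) (by norm_num) above₁
    ((hσ₂ 1 (by norm_num)).trans ((hσ₁ 1 (by norm_num)).trans (hσ 1 (by norm_num)))) hn hm₂
    fun v hv σ₃ hσ₃ h19 hm₃ _ => ?_
  refine Ensures.forEach (x.RelaxInv h w a) Improves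
    (fun b m => x.Relaxed h a q u v b m) .refl (fun _ _ _ => .trans) (fun b _ _ hi h => h.improves hi) (by norm_num) relaxBody_above
    ((hσ₃ 2 (by norm_num)).trans ((hσ₂ 2 (by norm_num)).trans ((hσ₁ 2 (by norm_num)).trans
      (hσ 2 (by norm_num))))) hT hm₃ fun b hb σ₄ hσ₄ h20 hm₄ _ => ?_
  have hreg : ∀ i < 17, σ₄.reg i = σ.reg i := fun i hi => by
    rw [hσ₄ i (by omega), hσ₃ i (by omega), hσ₂ i (by omega), hσ₁ i hi]
  refine (relaxBody_step (u := ⟨u, hu⟩) (v := ⟨v, hv⟩) (b := ⟨b, hb⟩) hB hK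
    (fun i hi => (hreg i (by omega)).trans (hσ i hi)) hq ((hreg 16 (by norm_num)).trans h16)
    ?_ ?_ ?_ h20 hm₄)
  · rw [hσ₄ 17 (by norm_num), hσ₃ 17 (by norm_num), hσ₂ 17 (by norm_num), h17]
  · rw [hσ₄ 18 (by norm_num), hσ₃ 18 (by norm_num), h18]
  · rw [hσ₄ 19 (by norm_num), h19]

/-- The table is complete at time `t` once all moves that depart before `t` are taken into
account. -/
theorem completeAt_of_relaxed {t : ℕ} (hK : ∀ v, h v < x.numLabels)
    (hstart : Grants (m (x.cell (2 ^ h x.source) x.source 0)) 0)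
    (hm : ∀ a < t, ∀ q < 2 ^ x.numLabels, ∀ u < x.n, ∀ v < x.n, ∀ b < x.T,
      x.Relaxed h a q u v b m) : x.CompleteAt h t m := by
  intro q v c hr
  cases hr with
  | start => exact hstart
  | @move q c c' u a b v hr hc =>
    exact hm a (lt_of_cost_eq_natCast hc) q (hr.lt_two_pow hK) u u.2 v v.2 b b.2 u v a b c c' rfl rfl rfl rfl hr hc

theorem relaxProg_ensures (hB : x.Fits B) (hK : ∀ v, h v < x.numLabels) (hσ : x.Ready σ)
    (hm : x.Holds h w σ.mem) (hs : x.Sound h σ.mem)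
    (hstart : Grants (σ.mem (x.cell (2 ^ h x.source) x.source 0)) 0) :
    relaxProg.Ensures B σ fun τ => x.Holds h w τ.mem ∧ x.Sound h τ.mem ∧
      ∀ t ≤ x.T, x.CompleteAt h t τ.mem := by
  refine (Ensures.forEach (N := x.T) (fun m => x.Holds h w m ∧ x.Sound h m ∧
      Grants (m (x.cell (2 ^ h x.source) x.source 0)) 0) Improves
    (fun a m => ∀ q < 2 ^ x.numLabels, ∀ u < x.n, ∀ v < x.n, ∀ b < x.T,
      x.Relaxed h a q u v b m) .refl (fun _ _ _ => .trans) ?_ (by norm_num)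
    ?_ (hσ 2 (by norm_num)) ((Nat.le_succ _).trans hB.T) ⟨hm, hs, hstart⟩ ?_).mono ?_
  · exact fun a m₁ m₂ hi h q hq u hu v hv b hb => (h q hq u hu v hv b hb).improves hi
  · simp only [forLoop, Prog.Above, relaxBody_above.mono (show 17 ≤ 21 by norm_num)]
    simp
  · rintro a ha τ hτ h16 ⟨h₁, h₂, h₃⟩ hprev
    refine (relaxProg_step (a := ⟨a, ha⟩) hB hK (fun i hi => (hτ i (by omega)).trans (hσ i hi)) h16
      ⟨h₁, h₂, completeAt_of_relaxed hK h₃ hprev⟩).mono ?_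
    rintro ρ ⟨⟨h₄, h₅, -⟩, h₆, h₇⟩
    exact ⟨⟨h₄, h₅, h₆ _ _ h₃⟩, h₆, h₇⟩
  · rintro τ ⟨⟨h₁, h₂, h₃⟩, -, h₄⟩
    exact ⟨h₁, h₂, fun t ht => completeAt_of_relaxed hK h₃ fun a ha => h₄ a (by omega)⟩

end CCTOInstance

/-! ### The rounds, one for each hash function -/

namespace CCTOInstance

open RAM RAM.Prog TemporalCostGraph

variable {x : CCTOInstance} {B : ℕ} {σ : State} {h : Fin x.n → ℕ} {w : ℕ} {m m' : ℕ → ℕ}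

/-- The hash function with the modulus `p + 1` and the factor `a`. -/
def hash (x : CCTOInstance) (p a : ℕ) (v : Fin x.n) : ℕ := a * v.val % (p + 1) % x.numLabels

theorem numLabels_pos (x : CCTOInstance) : 0 < x.numLabels := by
  unfold numLabels; positivity

theorem hash_lt (p a : ℕ) (v : Fin x.n) : x.hash p a v < x.numLabels :=
  Nat.mod_lt _ x.numLabels_pos

/-- The memory holds the input and the answer `w` so far. -/
structure HoldsInput (x : CCTOInstance) (w : ℕ) (m : ℕ → ℕ) : Prop where
  input : ∀ i < x.encode.length, m i = x.encode.getD i 0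
  answer : m x.encode.length = w

theorem labelProg_ensures (hB : x.Fits B) (hσ : x.Ready σ) {p a : ℕ}
    (ha : a < x.n + x.n) (h14 : σ.reg 14 = p) (h15 : σ.reg 15 = a) (hm : x.HoldsInput w σ.mem) :
    labelProg.Ensures B σ fun τ => x.Holds (x.hash p a) w τ.mem := by
  have hn : x.n ≤ B := (Nat.le_add_left _ _).trans hB.n
  refine (Ensures.forEach (N := x.n) (x.HoldsInput w) (fun m m' => ∀ v : Fin x.n,
      m (x.encode.length + 1 + v.val) = x.hash p a v →
      m' (x.encode.length + 1 + v.val) = x.hash p a v)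
    (fun i m => ∀ v : Fin x.n, v.val = i → m (x.encode.length + 1 + v.val) = x.hash p a v)
    (fun _ _ h => h) (fun _ _ _ h₁ h₂ v h => h₂ v (h₁ v h)) (fun i _ _ hi h v hv => hi v (h v hv))
    (by norm_num) (Term.storeProg_above _ _ _) (hσ 1 (by norm_num)) hn hm ?_).mono
    fun τ hτ => ⟨hτ.1.input, hτ.1.answer, fun v => hτ.2.2 v v.2 v rfl⟩
  intro i hi τ hτ h16 hmτ _
  have h0 : τ.reg 0 = x.encode.length := (hτ 0 (by norm_num)).trans (hσ 0 (by norm_num))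
  have h7 : τ.reg 7 = x.numLabels := (hτ 7 (by norm_num)).trans (hσ 7 (by norm_num))
  have h14 : τ.reg 14 = p := (hτ 14 (by norm_num)).trans h14
  have h15 : τ.reg 15 = a := (hτ 15 (by norm_num)).trans h15
  have hmul : a * i ≤ B := (Nat.mul_le_mul ha.le hi.le).trans hB.product
  have hmod : a * i % (p + 1) ≤ B := (Nat.mod_le _ _).trans hmul
  refine (Term.storeProg_ensures ?_ ?_ ?_ ?_).mono ?_
  · simp [Term.Below]
  · simp [Term.Below]
  · simp [Term.Bounded]
  · simp only [Term.Bounded, Term.eval, Op.fn, h14, h15, h16, hmul, hmod, and_true, true_and]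
    exact ha.le.trans hB.n
  · intro ρ hρ
    simp only [Term.eval, Op.fn, h0, h7, h14, h15, h16] at hρ
    refine ⟨⟨fun j hj => ?_, ?_⟩, fun v hv => ?_, fun v hv => ?_⟩
    · rw [hρ, Function.update_of_ne (by omega), hmτ.input j hj]
    · rw [hρ, Function.update_of_ne (by omega), hmτ.answer]
    · rw [hρ]
      by_cases hvi : v.val = i
      · rw [hvi, Function.update_self, hash, hvi]
      · rwa [Function.update_of_ne (by omega)]
    · rw [hρ, hv, Function.update_self, hash, hv]

theorem clearProg_ensures (hB : x.Fits B) (hσ : x.Ready σ) (hm : x.Holds h w σ.mem) :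
    clearProg.Ensures B σ fun τ => x.Holds h w τ.mem ∧ ∀ q < 2 ^ x.numLabels, ∀ v : Fin x.n,
      ∀ t ≤ x.T, τ.mem (x.cell q v t) = 0 := by
  refine (Ensures.forEach (N := (x.T + 1) * (x.n * 2 ^ x.numLabels)) (x.Holds h w)
    (fun m m' => ∀ i, m (x.encode.length + (1 + x.n) + i) = 0 →
      m' (x.encode.length + (1 + x.n) + i) = 0)
    (fun i m => m (x.encode.length + (1 + x.n) + i) = 0)
    (fun _ _ h => h) (fun _ _ _ h₁ h₂ v h => h₂ v (h₁ v h)) (fun i _ _ hi h => hi i h)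
    (by norm_num) (Term.storeProg_above _ _ _) (hσ 13 (by norm_num)) hB.table hm ?_).mono
    fun τ hτ => ⟨hτ.1, fun q hq v t ht => hτ.2.2 _
      (Nat.mul_add_lt_mul (Nat.mul_add_lt_mul hq v.2) (Nat.lt_succ_of_le ht))⟩
  intro i hi τ hτ h16 hmτ _
  have h10 : τ.reg 10 = x.encode.length + (1 + x.n) :=
    (hτ 10 (by norm_num)).trans (hσ 10 (by norm_num))
  refine (Term.storeProg_ensures ?_ ?_ ?_ ?_).mono ?_
  · simp [Term.Below]
  · simp [Term.Below]
  · simp [Term.Bounded]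
  · simp [Term.Bounded]
  · intro ρ hρ
    simp only [Term.eval, h10, h16] at hρ
    refine ⟨hρ ▸ hmτ.update (Nat.le_add_right _ _) _, fun j hj => ?_, by rw [hρ]; simp⟩
    rw [hρ, Function.update_apply]
    split_ifs <;> simp [hj]

theorem startProg_ensures (hB : x.Fits B) (hK : ∀ v, h v < x.numLabels) (hσ : x.Ready σ)
    (hm : x.Holds h w σ.mem) (h0 : ∀ q < 2 ^ x.numLabels, ∀ v : Fin x.n, ∀ t ≤ x.T,
      σ.mem (x.cell q v t) = 0) :
    startProg.Ensures B σ fun τ => x.Holds h w τ.mem ∧ x.Sound h τ.mem ∧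
      Grants (τ.mem (x.cell (2 ^ h x.source) x.source 0)) 0 := by
  have h0' : σ.reg 0 = x.encode.length := hσ 0 (by norm_num)
  have h1 : σ.reg 1 = x.n := hσ 1 (by norm_num)
  have h3 : σ.reg 3 = x.source := hσ 3 (by norm_num)
  have h9 : σ.reg 9 = x.T + 1 := hσ 9 (by norm_num)
  have h10 : σ.reg 10 = x.encode.length + (1 + x.n) := hσ 10 (by norm_num)
  have hlab := hm.label x.source
  refine (Term.storeProg_ensures ?_ ?_ ?_ ?_).mono ?_
  · simp [Term.Below, cellTerm, labelTerm]
  · simp [Term.Below]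
  · simp only [Term.Bounded, cellTerm, labelTerm, Term.eval, h0', h1, h3, h9, hlab, and_true,
      true_and]
    exact ⟨hB.T, (Nat.le_add_left _ _).trans hB.n, (hK _).le.trans hB.labels⟩
  · simp [Term.Bounded]
  · intro τ hτ
    replace hτ : τ.mem = Function.update σ.mem (x.cell (2 ^ h x.source) x.source 0) 1 := by
      simpa only [Term.eval, cellTerm, labelTerm, Op.fn, h0', h1, h3, h9, h10, hlab, cell] using hτ
    refine ⟨hτ ▸ hm.update (le_cell _ _ _) _, ?_, by rw [hτ, Function.update_self]; simp [Grants]⟩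
    intro q hq v t ht hne
    by_cases heq : x.cell q v t = x.cell (2 ^ h x.source) x.source 0
    · obtain ⟨rfl, rfl, rfl⟩ := cell_inj ht (Nat.zero_le _) heq
      exact ⟨0, .start, by rw [hτ, Function.update_self]⟩
    · rw [hτ, Function.update_of_ne heq, h0 q hq v t ht] at hne
      exact absurd rfl hne

/-- The answer in the memory is `0` or `1`, and it is `1` only if the answer is yes. -/
def Honest (x : CCTOInstance) (m : ℕ → ℕ) : Prop :=
  (∀ i < x.encode.length, m i = x.encode.getD i 0) ∧
    (m x.encode.length = 0 ∨ m x.encode.length = 1 ∧ x.IsYes)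

/-- The answer yes is not withdrawn. -/
def Keeps (x : CCTOInstance) (m m' : ℕ → ℕ) : Prop :=
  m x.encode.length = 1 → m' x.encode.length = 1

theorem answerProg_ensures (hB : x.Fits B) (hK : ∀ v, h v < x.numLabels) (hσ : x.Ready σ)
    (hw : w = 0 ∨ w = 1 ∧ x.IsYes) (hm : x.Holds h w σ.mem) (hs : x.Sound h σ.mem)
    (hc : ∀ t ≤ x.T, x.CompleteAt h t σ.mem) :
    answerProg.Ensures B σ fun τ => x.Honest τ.mem ∧ x.Keeps σ.mem τ.mem ∧
      (x.Reveals x.numLabels h → τ.mem x.encode.length = 1) := by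
  have hT := hB.T
  have hn : x.n ≤ B := (Nat.le_add_left _ _).trans hB.n
  have hKB := hB.labels
  -- The table stays as it is while the answer is looked up.
  let J : (ℕ → ℕ) → Prop := fun m =>
    x.Honest m ∧ ∀ i, x.encode.length + (1 + x.n) ≤ i → m i = σ.mem i
  let P : ℕ → ℕ → (ℕ → ℕ) → Prop := fun q t m => ∀ c, x.G.Reach h x.source q x.sink t c →
    c ≤ x.budget → x.target ≤ Op.count.fn x.numLabels q → m x.encode.length = 1
  have hkeeps : ∀ q t m₁ m₂, x.Keeps m₁ m₂ → P q t m₁ → P q t m₂ :=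
    fun q t m₁ m₂ hk hP c h₁ h₂ h₃ => hk (hP c h₁ h₂ h₃)
  have above : (forLoop 17 9 (Term.storeProg 18 (.reg 0)
      (.ite (.load (cellTerm (.reg 16) (.reg 4) (.reg 17)))
      (.ite (.sub (.add (.reg 6) (.const 2)) (.load (cellTerm (.reg 16) (.reg 4) (.reg 17))))
        (.ite (.sub (.add (.op .count (.reg 7) (.reg 16)) (.const 1)) (.reg 5)) (.const 1)
          (.load (.reg 0))) (.load (.reg 0))) (.load (.reg 0))))).Above 17 :=
    forLoop_above le_rfl ((Term.storeProg_above _ _ _).mono (by norm_num))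
  refine (Ensures.forEach (N := 2 ^ x.numLabels) J x.Keeps (fun q m => ∀ t < x.T + 1, P q t m)
    (fun _ h => h) (fun _ _ _ h₁ h₂ h => h₂ (h₁ h)) (fun q m₁ m₂ hk hP t ht =>
      hkeeps q t m₁ m₂ hk (hP t ht)) (by norm_num) above (hσ 8 (by norm_num)) hB.pow
      ⟨⟨hm.input, by rw [hm.answer]; exact hw⟩, fun _ _ => rfl⟩ ?_).mono ?_
  · intro q hq σ₁ hσ₁ h16 hm₁ _
    refine Ensures.forEach (N := x.T + 1) J x.Keeps (P q) (fun _ h => h)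
      (fun _ _ _ h₁ h₂ h => h₂ (h₁ h)) (hkeeps q) (by norm_num) (Term.storeProg_above _ _ _)
      ((hσ₁ 9 (by norm_num)).trans (hσ 9 (by norm_num))) hB.T hm₁ ?_
    intro t ht σ₂ hσ₂ h17 hm₂ _
    have hreg : ∀ i < 14, σ₂.reg i = x.param i := fun i hi => by
      rw [hσ₂ i (by omega), hσ₁ i (by omega), hσ i hi]
    have h0 : σ₂.reg 0 = x.encode.length := hreg 0 (by norm_num)
    have h1 : σ₂.reg 1 = x.n := hreg 1 (by norm_num)
    have h4 : σ₂.reg 4 = x.sink := hreg 4 (by norm_num)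
    have h5 : σ₂.reg 5 = x.target := hreg 5 (by norm_num)
    have h6 : σ₂.reg 6 = x.budget := hreg 6 (by norm_num)
    have h7 : σ₂.reg 7 = x.numLabels := hreg 7 (by norm_num)
    have h9 : σ₂.reg 9 = x.T + 1 := hreg 9 (by norm_num)
    have h10 : σ₂.reg 10 = x.encode.length + (1 + x.n) := hreg 10 (by norm_num)
    have h16 : σ₂.reg 16 = q := (hσ₂ 16 (by norm_num)).trans h16
    have hcell : (Term.load (cellTerm (.reg 16) (.reg 4) (.reg 17))).eval σ₂ =
        σ.mem (x.cell q x.sink t) := by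
      simp only [cellTerm, Term.eval, Op.fn, h1, h4, h9, h10, h16, h17]
      exact hm₂.2 _ (le_cell _ _ _)
    refine (Term.storeProg_ensures ?_ ?_ ?_ ?_).mono ?_
    · simp [Term.Below]
    · simp [Term.Below, cellTerm]
    · simp [Term.Bounded]
    · simp [Term.Bounded, cellTerm, Term.eval, h1, h7, h9, hT, hn, hKB]
    · intro τ hτ
      have hval : τ.mem = Function.update σ₂.mem x.encode.length
          (if σ.mem (x.cell q x.sink t) ≠ 0 ∧ σ.mem (x.cell q x.sink t) ≤ x.budget + 1 ∧
            x.target ≤ Op.count.fn x.numLabels q then 1 else σ₂.mem x.encode.length) := by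
        rw [hτ]
        simp only [Term.eval, h0] at hcell ⊢
        simp only [hcell, h5, h6, h7, h16]
        congr 1
        generalize σ.mem (x.cell q x.sink t) = e
        generalize Op.count.fn x.numLabels q = k
        split_ifs <;> first | rfl | omega
      have hτe : ∀ i, i ≠ x.encode.length → τ.mem i = σ₂.mem i := fun i hi => by
        rw [hval, Function.update_of_ne hi]
      have hτa : τ.mem x.encode.length = if σ.mem (x.cell q x.sink t) ≠ 0 ∧
          σ.mem (x.cell q x.sink t) ≤ x.budget + 1 ∧ x.target ≤ Op.count.fn x.numLabels q then 1
          else σ₂.mem x.encode.length := by rw [hval, Function.update_self]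
      refine ⟨⟨⟨fun i hi => ?_, ?_⟩, fun i hi => ?_⟩, fun h₁ => ?_, fun c h₁ h₂ h₃ => ?_⟩
      · rw [hτe i (by omega), hm₂.1.1 i hi]
      · rw [hτa]
        split_ifs with hif
        · obtain ⟨c, hr, hc⟩ := hs q hq x.sink t (Nat.le_of_lt_succ ht) hif.1
          exact .inr ⟨rfl, Reveals.isYes (K := x.numLabels)
            ⟨q, t, c, Nat.le_of_lt_succ ht, hr, by omega, hif.2.2⟩⟩
        · exact hm₂.1.2
      · rw [hτe i (by omega), hm₂.2 i hi]
      · rw [hτa, h₁]; simp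
      · have := hc t (Nat.le_of_lt_succ ht) q x.sink c h₁
        rw [hτa, if_pos ⟨this.1.ne', this.2.trans (by omega), h₃⟩]
  · rintro τ ⟨h₁, h₂, h₃⟩
    refine ⟨h₁.1, h₂, ?_⟩
    rintro ⟨q, t, c, ht, hr, hc, hk⟩
    exact h₃ q (hr.lt_two_pow hK) t (Nat.lt_succ_of_le ht) c hr hc hk

/-- Programs that assign to no parameter can be dealt with one after the other. -/
theorem ensures_seq_of_ready {p q : Prog} {Q R : State → Prop} (hσ : x.Ready σ)
    (hp : p.Ensures B σ Q) (habove : p.Above 14)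
    (hq : ∀ τ, x.Ready τ → Q τ → q.Ensures B τ R) : (Prog.seq p q).Ensures B σ R :=
  .seq ((hp.frame habove).mono fun τ hτ => hq τ (fun i hi => (hτ.2 i hi).trans (hσ i hi)) hτ.1)

theorem roundProg_above : roundProg.Above 16 := by
  simp only [roundProg, labelProg, clearProg, startProg, relaxProg, answerProg, Prog.Above, forLoop,
    (Term.storeProg_above 17 _ _).mono (show 16 ≤ 17 by norm_num), Term.storeProg_above 16,
    (Term.storeProg_above 18 _ _).mono (show 16 ≤ 18 by norm_num),
    relaxBody_above.mono (show 16 ≤ 21 by norm_num)]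
  simp

theorem roundProg_ensures (hB : x.Fits B) (hσ : x.Ready σ) {p a : ℕ}
    (ha : a < x.n + x.n) (h14 : σ.reg 14 = p) (h15 : σ.reg 15 = a) (hm : x.Honest σ.mem) :
    roundProg.Ensures B σ fun τ => x.Honest τ.mem ∧ x.Keeps σ.mem τ.mem ∧
      (x.Reveals x.numLabels (x.hash p a) → τ.mem x.encode.length = 1) := by
  have hK := x.hash_lt p a
  obtain ⟨h₁, h₂, h₃, h₄, h₅⟩ := roundProg_above
  refine ensures_seq_of_ready hσ (labelProg_ensures hB hσ ha h14 h15 ⟨hm.1, rfl⟩)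
    (h₁.mono (by norm_num)) fun τ hτ h₆ => ?_
  refine ensures_seq_of_ready hτ (clearProg_ensures hB hτ h₆) (h₂.mono (by norm_num))
    fun τ hτ h₇ => ?_
  refine ensures_seq_of_ready hτ (startProg_ensures hB hK hτ h₇.1 h₇.2) (h₃.mono (by norm_num))
    fun τ hτ h₈ => ?_
  refine ensures_seq_of_ready hτ (relaxProg_ensures hB hK hτ h₈.1 h₈.2.1 h₈.2.2)
    (h₄.mono (by norm_num)) fun τ hτ h₉ => ?_
  refine (answerProg_ensures hB hK hτ hm.2 h₉.1 h₉.2.1 h₉.2.2).mono ?_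
  rintro ρ ⟨h₁₀, h₁₁, h₁₂⟩
  exact ⟨h₁₀, fun h => h₁₁ (by rw [h₉.1.answer, h]), h₁₂⟩

/-! ### The whole program -/

theorem mainProg_ensures (hB : x.Fits B) : mainProg.Ensures B (init x.encode) fun τ =>
    (x.IsYes → τ.reg 0 = 1) ∧ (¬ x.IsYes → τ.reg 0 = 0) := by
  refine .seq ((setupProg_ensures hB).mono ?_)
  rintro σ ⟨hm, hσ⟩
  have hhon : x.Honest σ.mem := by
    rw [hm]
    exact ⟨fun _ _ => rfl, .inl (by simp [init])⟩
  have above : (forLoop 15 12 roundProg).Above 15 :=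
    forLoop_above le_rfl (roundProg_above.mono (by norm_num))
  have hloop : (forLoop 14 12 (forLoop 15 12 roundProg)).Ensures B σ fun τ => x.Honest τ.mem ∧
      x.Keeps σ.mem τ.mem ∧ ∀ p < x.n + x.n, ∀ a < x.n + x.n,
        x.Reveals x.numLabels (x.hash p a) → τ.mem x.encode.length = 1 := by
    refine Ensures.forEach (N := x.n + x.n) x.Honest x.Keeps (fun p m => ∀ a < x.n + x.n,
        x.Reveals x.numLabels (x.hash p a) → m x.encode.length = 1) (fun _ h => h)
      (fun _ _ _ h₁ h₂ h => h₂ (h₁ h)) (fun _ _ _ hk h a ha hr => hk (h a ha hr)) (by norm_num)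
      above (hσ 12 (by norm_num)) hB.n hhon fun p _ σ₁ hσ₁ h14 hm₁ _ => ?_
    refine Ensures.forEach (N := x.n + x.n) x.Honest x.Keeps (fun a m =>
        x.Reveals x.numLabels (x.hash p a) → m x.encode.length = 1) (fun _ h => h)
      (fun _ _ _ h₁ h₂ h => h₂ (h₁ h)) (fun _ _ _ hk h hr => hk (h hr)) (by norm_num)
      roundProg_above ((hσ₁ 12 (by norm_num)).trans (hσ 12 (by norm_num))) hB.n hm₁
      fun a ha σ₂ hσ₂ h15 hm₂ _ => ?_
    exact roundProg_ensures hB (fun i hi => by rw [hσ₂ i (by omega), hσ₁ i hi, hσ i hi]) ha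
      ((hσ₂ 14 (by norm_num)).trans h14) h15 hm₂
  refine .seq ((hloop.frame (forLoop_above le_rfl (above.mono (by norm_num)))).mono ?_)
  rintro τ ⟨⟨h₁, -, h₂⟩, hτ⟩
  have h0 : τ.reg 0 = x.encode.length := (hτ 0 (by norm_num)).trans (hσ 0 (by norm_num))
  refine .assign ?_
  simp only [Expr.eval, h0, Function.update_self]
  constructor
  · intro hx
    obtain ⟨p, hp, a, ha, hr⟩ := hx.exists_reveals
    exact h₂ p (by omega) a (by omega) hr
  · intro hx
    exact h₁.2.resolve_right fun h => hx h.2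

/-- A bound for the numbers of passes of all loops. -/
def loopBound (x : CCTOInstance) : ℕ :=
  (x.T + 1) * (x.n * 2 ^ x.numLabels) + (x.n + x.n) * x.n + (x.n + x.n) + (x.T + 1) +
    2 ^ x.numLabels

theorem fits_loopBound (x : CCTOInstance) : x.Fits x.loopBound := by
  have h₁ : x.numLabels < 2 ^ x.numLabels := Nat.lt_two_pow_self
  have h₂ : x.budget + 1 ≤ x.numLabels := Nat.le_mul_self _
  constructor <;> unfold loopBound <;> omega

theorem loopBound_add_one_le (x : CCTOInstance) :
    x.loopBound + 1 ≤ 8 * 2 ^ x.numLabels * inputSize x.encode ^ 2 := by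
  have hlen : x.encode.length ≤ inputSize x.encode := by
    have : ∀ l : List ℕ, l.length ≤ inputSize l := fun l => by
      induction l with
      | nil => simp
      | cons a l ih => simp only [inputSize, List.map_cons, List.sum_cons, List.length_cons] at ih ⊢
                       omega
    exact this _
  rw [length_encode] at hlen
  have hn : 1 ≤ x.n := Nat.one_le_iff_ne_zero.2 fun h => by have := x.source.2; omega
  set N := inputSize x.encode
  have hN : 6 + x.n ≤ N := by
    have := Nat.le_mul_self x.n
    have := Nat.zero_le (x.n * (x.n * (x.T * x.T)))
    omega
  have hT : x.T + 1 ≤ N := by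
    have h₁ := Nat.le_mul_self x.T
    have h₂ : x.T * x.T ≤ x.n * (x.n * (x.T * x.T)) :=
      (Nat.le_mul_of_pos_left _ hn).trans (Nat.le_mul_of_pos_left _ hn)
    omega
  have hQ : 1 ≤ 2 ^ x.numLabels := Nat.one_le_two_pow
  set Q := 2 ^ x.numLabels with hQdef
  have e₁ : (x.T + 1) * (x.n * Q) ≤ Q * N ^ 2 := by
    calc (x.T + 1) * (x.n * Q) ≤ N * (N * Q) := by gcongr; omega
      _ = Q * N ^ 2 := by ring
  have e₂ : (x.n + x.n) * x.n ≤ 2 * N ^ 2 := by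
    calc (x.n + x.n) * x.n ≤ (N + N) * N := by gcongr <;> omega
      _ = 2 * N ^ 2 := by ring
  have e₃ : N ≤ N ^ 2 := Nat.le_self_pow (by norm_num) N
  have e₄ : N ^ 2 ≤ Q * N ^ 2 := Nat.le_mul_of_pos_left _ hQ
  have e₅ : Q ≤ Q * N ^ 2 := Nat.le_mul_of_pos_right _ (by nlinarith)
  have e₆ : (x.n + x.n) + (x.T + 1) + 1 ≤ 3 * N := by omega
  rw [loopBound, ← hQdef]
  have : 8 * Q * N ^ 2 = 8 * (Q * N ^ 2) := by ring
  omega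

end CCTOInstance

theorem computable_weight_mul_pow (W D : ℕ) :
    Computable fun f : ℕ => W * (8 * 2 ^ ((f + 1) * (f + 1))) ^ D := by
  have hpow : Primrec fun n : ℕ => 2 ^ n := by
    refine (Primrec.nat_rec₁ 1 (Primrec.nat_mul.comp (Primrec.const 2) Primrec.snd).to₂).of_eq ?_
    intro n
    induction n with
    | zero => rfl
    | succ n ih => simp only [pow_succ']; rw [← ih]
  have hsq : Primrec fun f : ℕ => 8 * 2 ^ ((f + 1) * (f + 1)) :=
    Primrec.nat_mul.comp (Primrec.const 8)
      (hpow.comp (Primrec.nat_mul.comp Primrec.succ Primrec.succ))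
  have hD : ∀ D : ℕ, Primrec fun f : ℕ => (8 * 2 ^ ((f + 1) * (f + 1))) ^ D := by
    intro D
    induction D with
    | zero => exact Primrec.const 1
    | succ D ih => exact (Primrec.nat_mul.comp ih hsq).of_eq fun f => by rw [pow_succ]
  exact (Primrec.nat_mul.comp (Primrec.const W) (hD D)).to_comp

theorem mainTheorem7 :
    RAM.FixedParameterTractable CCTOInstance.encode CCTOInstance.budget CCTOInstance.IsYes := by
  refine ⟨CCTOInstance.mainProg, _, 2 * CCTOInstance.mainProg.depth, computable_weight_mul_pow
    CCTOInstance.mainProg.weight CCTOInstance.mainProg.depth, fun x => ?_⟩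
  obtain ⟨t, τ, he, ht, hτ⟩ := CCTOInstance.mainProg_ensures x.fits_loopBound
  refine ⟨t, τ, he, ht.trans ?_, hτ⟩
  calc CCTOInstance.mainProg.weight * (x.loopBound + 1) ^ CCTOInstance.mainProg.depth
      ≤ CCTOInstance.mainProg.weight * (8 * 2 ^ x.numLabels * RAM.inputSize x.encode ^ 2) ^
        CCTOInstance.mainProg.depth := by gcongr; exact x.loopBound_add_one_le
    _ = _ := by rw [mul_pow, ← pow_mul, ← mul_assoc]; rfl
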